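/- Let $N\in\mathbb{N}$ and let $(\theta_j)_{0\le j\le N}$ be a probability distribution on $\{0,1,\dots,N\}$ with mean $m=\sum_{j=0}^N j\,\theta_j>1$. Consider the Galton–Watson tree with this offspring distribution: starting from a single root, the numbers of children of the vertices are independent with law $\theta$. Let $F_\tau$ be its Gromov boundary, i.e. the set of infinite descending paths from the root, with the metric $d(x,y)=2^{-|x\wedge y|}$ for $x\ne y$, where $|x\wedge y|$ is the level of the last common vertex of $x$ and $y$ (the root has level $0$). For a subset $A$ of a metric space let $N_r(A)$ be the least number of sets of radius at most $r$ (sets contained in a closed ball of radius $r$) needed to cover $A$, and let $\dim_B F=\lim_{r\to0}\frac{\log N_r(F)}{-\log r}$ when this limit exists. A function $\phi:(0,1)\to[0,\infty)$ is a dimension function if $\phi(x)$ and $\phi(x)|\log x|$ are both monotone (each either non-decreasing or non-increasing) for all sufficiently small $x>0$. The $\phi$-Assouad dimension $\dim_A^\phi F$ is the infimum of all $s\in\mathbb{R}$ for which there is $C>0$ such that $$N_r(F\cap B(x,R))\le C\left(\frac{R}{r}\right)^s\qquad\text{for all } 0<r=R^{1+\phi(R)}<R<1\text{ and all }x\in F,$$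 where $B(x,R)$ is the closed ball. Theorem. Let $\varepsilon>0$ and let $\phi$ be a dimension function with $$\phi(x)>\frac{\log|\log x|}{|\log x|}\,(\varepsilon\log m)^{-1}\qquad\text{for all sufficiently small }x>0.$$ Then, almost surely on the event of non-extinction (the tree has vertices at every level), $\dim_B F_\tau$ exists as a real number and $$\dim_A^\phi F_\tau\le(1+\varepsilon)\dim_B F_\tau .$$ -/

import Mathlib

open MeasureTheory ProbabilityTheory Filter Topology Set
open scoped ENNReal NNReal

/-! ### Dimensions -/

/-- `N_r(A)`: the least number of sets of radius at most `r` (that is, sets contained in a closed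
ball of radius `r`) needed to cover `A`; it is `∞` if no finite cover exists. -/
noncomputable def coverNumber {α : Type*} [PseudoMetricSpace α] (r : ℝ) (A : Set α) : ℝ≥0∞ :=
  ((Metric.externalCoveringNumber r.toNNReal A : ℕ∞) : ℝ≥0∞)

/-- Dimension functions `φ : ℝ⁺ → ℝ⁺`: both `φ(x)` and `φ(x)|log x|` are monotone (in either
direction) as `x` decreases to `0`.  Only values at `x ∈ (0, 1)` are ever used. -/
def IsDimensionFunction (φ : ℝ → ℝ) : Prop :=
  (∀ x ∈ Ioo (0 : ℝ) 1, 0 ≤ φ x) ∧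
  ∃ δ > (0 : ℝ),
    (MonotoneOn φ (Ioo 0 δ) ∨ AntitoneOn φ (Ioo 0 δ)) ∧
    (MonotoneOn (fun x => φ x * |Real.log x|) (Ioo 0 δ) ∨
      AntitoneOn (fun x => φ x * |Real.log x|) (Ioo 0 δ))

/-- The generalised Assouad spectrum `dim_A^φ F`: the infimum of the `s` for which there is `C > 0`
such that `N_r(F ∩ B(x, R)) ≤ C (R / r)^s` for all `0 < r = R^(1 + φ(R)) < R < 1` and `x ∈ F`. -/
noncomputable def phiAssouadDim {α : Type*} [PseudoMetricSpace α] (φ : ℝ → ℝ) (F : Set α) :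
    EReal :=
  sInf ((fun s : ℝ => (s : EReal)) '' {s : ℝ | ∃ C > (0 : ℝ), ∀ r R : ℝ,
    0 < r → r = R ^ (1 + φ R) → r < R → R < 1 →
      ∀ x ∈ F, coverNumber r (F ∩ Metric.closedBall x R) ≤ ENNReal.ofReal (C * (R / r) ^ s)})

/-- The box-counting dimension `dim_B F` exists and equals `d`:
`log N_r(F) / (-log r) → d` as `r → 0⁺`. -/
def HasBoxDim {α : Type*} [PseudoMetricSpace α] (F : Set α) (d : ℝ) : Prop :=
  Tendsto (fun r : ℝ => ENNReal.log (coverNumber r F) / ((-Real.log r : ℝ) : EReal))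
    (𝓝[>] 0) (𝓝 (d : EReal))

/-! ### Trees and their Gromov boundaries

Vertices are labelled by finite words: the root is `[]`, and `i :: u` is the `i`-th child of `u`
(counting from `0`), so the level of a vertex is the length of its word. -/

/-- The word `u` is a vertex of the rooted tree in which every vertex `v` has `c v` children. -/
def IsVertex (c : List ℕ → ℕ) : List ℕ → Prop
  | [] => True
  | i :: v => i < c v ∧ IsVertex c v

/-- The set of vertices at level `k`. -/
def treeLevel (c : List ℕ → ℕ) (k : ℕ) : Set (List ℕ) :=
  {u | IsVertex c u ∧ u.length = k}

/-- Infinite descending paths in the tree of all finite words; `ξ k` is the label of the child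
chosen at level `k`. -/
def Ray : Type := ℕ → ℕ

/-- The metric `d(ξ, η) = 2 ^ (-|ξ ∧ η|)` for `ξ ≠ η`, where `|ξ ∧ η|` is the first index at which
`ξ` and `η` differ, that is, the level of their last common vertex. -/
noncomputable instance Ray.metricSpace : MetricSpace Ray := PiNat.metricSpaceNatNat

/-- The vertex at level `k` on the path `ξ`. -/
def Ray.vertex (ξ : Ray) : ℕ → List ℕ
  | 0 => []
  | k + 1 => ξ k :: Ray.vertex ξ k

/-- The Gromov boundary of the tree: the infinite descending paths from the root inside it. -/
def gromovBoundary (c : List ℕ → ℕ) : Set Ray :=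
  {ξ | ∀ k, IsVertex c (ξ.vertex k)}

/-! ### Offspring laws on `{0, …, N}` -/

/-- The mean `m = ∑ⱼ θⱼ j`. -/
noncomputable def offspringMean {N : ℕ} (θ : PMF (Fin (N + 1))) : ℝ :=
  ∑ j, (θ j).toReal * ((j : ℕ) : ℝ)

/-! Balls of radius `r` in the boundary are cylinders of level `⌈-log₂ r⌉`. Hence a ball of radius
`R` is covered at scale `r` by as many sets as a vertex of level `n` has descendants `l` levels
below, where `n` and `l` are given by `R` and `R / r` up to rounding
(`coverNumber_le_card_descendants`). The whole boundary needs at least as many sets as there are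
surviving vertices at the level of `r` (`card_survivors_le_coverNumber`).

Box dimension: on survival both the generation sizes and the numbers of survivors grow at rate `log
m`, so the dimension is `log m / log 2`. The lower rate comes from the iterated generating function
`f`: if `D` counts survivors at level `k` and `q` is the extinction probability, then `E[s ^ D] =
f^[k] (s + (1 - s) * q)`. For `1 - s` of order `m₁ ^ (-k)`, `1 < m₁ < m`, this tends to `q`
summably, and its excess over `q` controls the probability of survival with `D ≤ m₁ ^ k`.

Assouad bound: the condition on `φ` forces `n ≤ C * m ^ (ε * l)`, so only `exp (O (m ^ (ε * l)))`
vertices matter for a given `l`. A Chernoff bound gives each of them at least `b ^ l` descendants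
`l` levels below with probability at most `exp (a - a * (b / m') ^ l)`, for `m'` slightly above `m`.
If `b > m ^ (1 + ε)`, this beats the number of vertices, and Borel–Cantelli bounds all the relevant
vertices at once (`ae_card_descendants_lt`). Taking `b = 2 ^ s` with `s > (1 + ε) * log m / log 2`
gives the theorem. -/

/-! ### Descendants of a vertex -/

/-- The descendants of `v`, `l` levels below it, in the tree with child counts `c`. -/
def descendants (c : List ℕ → ℕ) : ℕ → List ℕ → Finset (List ℕ)
  | 0, v => {v}
  | l + 1, v => (Finset.range (c v)).biUnion fun i => descendants c l (i :: v)

/-- The vertex `v` has descendants at every level below it. -/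
def Survives (c : List ℕ → ℕ) (v : List ℕ) : Prop :=
  ∀ l, (descendants c l v).Nonempty

open Classical in
/-- The descendants of `v`, `l` levels below it, that have an infinite line of descent. -/
noncomputable def survivors (c : List ℕ → ℕ) (l : ℕ) (v : List ℕ) : Finset (List ℕ) :=
  (descendants c l v).filter (Survives c)

section Tree

variable {c : List ℕ → ℕ}

theorem mem_descendants_succ {l : ℕ} {v w : List ℕ} :
    w ∈ descendants c (l + 1) v ↔ ∃ i < c v, w ∈ descendants c l (i :: v) := by
  simp [descendants]

theorem length_of_mem_descendants {l : ℕ} {v w : List ℕ} (h : w ∈ descendants c l v) :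
    w.length = v.length + l := by
  induction l generalizing v with
  | zero => simp_all [descendants]
  | succ l ih =>
    obtain ⟨i, -, hi⟩ := mem_descendants_succ.1 h
    have := ih hi
    simp only [List.length_cons] at this
    omega

theorem isSuffix_of_mem_descendants {l : ℕ} {v w : List ℕ} (h : w ∈ descendants c l v) :
    v <:+ w := by
  induction l generalizing v with
  | zero => simp_all [descendants]
  | succ l ih =>
    obtain ⟨i, -, hi⟩ := mem_descendants_succ.1 h
    exact (List.suffix_cons i v).trans (ih hi)

theorem pairwiseDisjoint_descendants (c : List ℕ → ℕ) (l : ℕ) (v : List ℕ) (s : Set ℕ) :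
    s.PairwiseDisjoint fun i => descendants c l (i :: v) := by
  intro i _ j _ hij
  refine Finset.disjoint_left.2 fun w hi hj => hij ?_
  have h := List.suffix_of_suffix_length_le (isSuffix_of_mem_descendants hi)
    (isSuffix_of_mem_descendants hj) (by simp)
  have := h.eq_of_length (by simp)
  simpa using this

theorem prod_descendants_succ {M : Type*} [CommMonoid M] (f : List ℕ → M) (l : ℕ) (v : List ℕ) :
    ∏ w ∈ descendants c (l + 1) v, f w =
      ∏ i ∈ Finset.range (c v), ∏ w ∈ descendants c l (i :: v), f w :=
  Finset.prod_biUnion (pairwiseDisjoint_descendants c l v _)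

theorem card_descendants_succ (l : ℕ) (v : List ℕ) :
    (descendants c (l + 1) v).card = ∑ i ∈ Finset.range (c v), (descendants c l (i :: v)).card :=
  Finset.card_biUnion (pairwiseDisjoint_descendants c l v _)

theorem card_descendants_le {N : ℕ} (hc : ∀ v, c v ≤ N) (l : ℕ) (v : List ℕ) :
    (descendants c l v).card ≤ N ^ l := by
  induction l generalizing v with
  | zero => simp [descendants]
  | succ l ih =>
    rw [card_descendants_succ]
    calc _ ≤ ∑ i ∈ Finset.range (c v), N ^ l := Finset.sum_le_sum fun i _ => ih _
      _ = c v * N ^ l := by simp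
      _ ≤ N ^ (l + 1) := by rw [pow_succ']; exact Nat.mul_le_mul_right _ (hc v)

theorem descendants_mono {c' : List ℕ → ℕ} (h : ∀ v, c v ≤ c' v) (l : ℕ) (v : List ℕ) :
    descendants c l v ⊆ descendants c' l v := by
  induction l generalizing v with
  | zero => simp [descendants]
  | succ l ih =>
    intro w hw
    obtain ⟨i, hi, hw⟩ := mem_descendants_succ.1 hw
    exact mem_descendants_succ.2 ⟨i, hi.trans_le (h v), ih _ hw⟩

theorem cons_mem_descendants {l i : ℕ} {v w : List ℕ} (h : w ∈ descendants c l v)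
    (hi : i < c w) : i :: w ∈ descendants c (l + 1) v := by
  induction l generalizing v with
  | zero =>
    obtain rfl : w = v := by simpa [descendants] using h
    exact mem_descendants_succ.2 ⟨i, hi, by simp [descendants]⟩
  | succ l ih =>
    obtain ⟨j, hj, hw⟩ := mem_descendants_succ.1 h
    exact mem_descendants_succ.2 ⟨j, hj, ih hw⟩

theorem IsVertex.mem_descendants {u : List ℕ} (h : IsVertex c u) :
    u ∈ descendants c u.length [] := by
  induction u with
  | nil => simp [descendants]
  | cons i u ih => exact cons_mem_descendants (ih h.2) h.1

theorem IsVertex.of_mem_descendants {l : ℕ} {v w : List ℕ} (hv : IsVertex c v)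
    (h : w ∈ descendants c l v) : IsVertex c w := by
  induction l generalizing v with
  | zero =>
    obtain rfl : w = v := by simpa [descendants] using h
    exact hv
  | succ l ih =>
    obtain ⟨j, hj, hw⟩ := mem_descendants_succ.1 h
    exact ih (v := j :: v) ⟨hj, hv⟩ hw

theorem survives_root (h : ∀ k, (treeLevel c k).Nonempty) : Survives c [] := by
  intro k
  obtain ⟨u, hu, rfl⟩ := h k
  exact ⟨u, hu.mem_descendants⟩

theorem descendants_nonempty_of_succ {l : ℕ} {v : List ℕ}
    (h : (descendants c (l + 1) v).Nonempty) : (descendants c l v).Nonempty := by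
  induction l generalizing v with
  | zero => simp [descendants]
  | succ l ih =>
    obtain ⟨w, hw⟩ := h
    obtain ⟨i, hi, hw⟩ := mem_descendants_succ.1 hw
    obtain ⟨w', hw'⟩ := ih ⟨w, hw⟩
    exact ⟨w', mem_descendants_succ.2 ⟨i, hi, hw'⟩⟩

theorem descendants_nonempty_of_le {l l' : ℕ} (hl : l ≤ l') {v : List ℕ}
    (h : (descendants c l' v).Nonempty) : (descendants c l v).Nonempty := by
  induction l', hl using Nat.le_induction with
  | base => exact h
  | succ l' _ ih => exact ih (descendants_nonempty_of_succ h)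

theorem Survives.of_child {i : ℕ} {v : List ℕ} (hi : i < c v) (h : Survives c (i :: v)) :
    Survives c v := by
  intro l
  obtain ⟨w, hw⟩ := h l
  exact descendants_nonempty_of_succ ⟨w, mem_descendants_succ.2 ⟨i, hi, hw⟩⟩

/-- König's lemma: there are finitely many children, so if each line died out there would be a
common level by which all had. -/
theorem Survives.exists_child {v : List ℕ} (h : Survives c v) :
    ∃ i < c v, Survives c (i :: v) := by
  by_contra! hne
  have h' : ∀ i, ∃ l, i < c v → ¬ (descendants c l (i :: v)).Nonempty := by
    intro i
    by_cases hi : i < c v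
    · obtain ⟨l, hl⟩ := not_forall.1 (hne i hi)
      exact ⟨l, fun _ => hl⟩
    · exact ⟨0, fun h => absurd h hi⟩
  choose l hl using h'
  obtain ⟨w, hw⟩ := h ((Finset.range (c v)).sup l + 1)
  obtain ⟨i, hi, hw⟩ := mem_descendants_succ.1 hw
  exact hl i hi (descendants_nonempty_of_le
    (Finset.le_sup (f := l) (Finset.mem_range.2 hi)) ⟨w, hw⟩)

theorem Survives.of_mem_descendants {l : ℕ} {v w : List ℕ} (hw : w ∈ descendants c l v)
    (h : Survives c w) : Survives c v := by
  induction l generalizing v with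
  | zero =>
    obtain rfl : w = v := by simpa [descendants] using hw
    exact h
  | succ l ih =>
    obtain ⟨i, hi, hw⟩ := mem_descendants_succ.1 hw
    exact (ih hw).of_child hi

/-! ### Rays -/

theorem Ray.vertex_eq_iff {ξ η : Ray} {n : ℕ} :
    ξ.vertex n = η.vertex n ↔ ∀ i < n, ξ i = η i := by
  induction n with
  | zero => simp [Ray.vertex]
  | succ n ih =>
    simp only [Ray.vertex, List.cons.injEq, ih, Nat.lt_succ_iff_lt_or_eq]
    grind

theorem Ray.vertex_mem_descendants {ξ : Ray} (h : ξ ∈ gromovBoundary c) (n l : ℕ) :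
    ξ.vertex (n + l) ∈ descendants c l (ξ.vertex n) := by
  induction l with
  | zero => simp [descendants]
  | succ l ih => exact cons_mem_descendants ih (h (n + l + 1)).1

/-- Extend a surviving vertex to an infinite path. -/
theorem exists_ray_through {v : List ℕ} (hv : IsVertex c v) (hs : Survives c v) :
    ∃ ξ ∈ gromovBoundary c, ξ.vertex v.length = v := by
  choose! f hf using fun (u : List ℕ) (hu : Survives c u) => hu.exists_child
  let p : ℕ → List ℕ := fun n => Nat.rec v (fun _ u => f u :: u) n
  have hp0 : p 0 = v := rfl
  have hp1 : ∀ n, p (n + 1) = f (p n) :: p n := fun n => rfl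
  have hps : ∀ n, Survives c (p n) ∧ IsVertex c (p n) := by
    intro n
    induction n with
    | zero => exact ⟨hs, hv⟩
    | succ n ih => rw [hp1]; exact ⟨(hf _ ih.1).2, (hf _ ih.1).1, ih.2⟩
  -- Words carry the deepest label first, so the labels leading to `v` are read from `v.reverse`;
  -- below `v` the path follows the chosen surviving children.
  let ξ : Ray := fun k => if k < v.length then v.reverse.getD k 0 else f (p (k - v.length))
  have h1 : ∀ u : List ℕ, u <:+ v → ξ.vertex u.length = u := by
    intro u
    induction u with
    | nil => intro _; rfl
    | cons i u ih =>
      intro hu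
      have h2 : u.length < v.length := by simpa using hu.length_le
      have h3 := ih ((List.suffix_cons i u).trans hu)
      change ξ u.length :: ξ.vertex u.length = _
      rw [h3]
      congr 1
      obtain ⟨t, rfl⟩ := hu
      simp only [ξ, if_pos h2]
      simp
  have h2 := h1 v List.suffix_rfl
  have h3 : ∀ n, ξ.vertex (v.length + n) = p n := by
    intro n
    induction n with
    | zero => exact h2
    | succ n ih =>
      change ξ (v.length + n) :: ξ.vertex (v.length + n) = _
      rw [ih, hp1]
      simp [ξ]
  refine ⟨ξ, fun k => ?_, h2⟩
  have h4 : ∀ n, IsVertex c (ξ.vertex (k + n)) → IsVertex c (ξ.vertex k) := by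
    intro n
    induction n with
    | zero => exact id
    | succ n ih => exact fun h => ih h.2
  refine h4 v.length ?_
  rw [add_comm, h3]
  exact (hps k).2

/-! ### Covering numbers of the boundary -/

/-- The level at which balls of radius `r` in the boundary are cylinders. -/
noncomputable def ballLevel (r : ℝ) : ℕ := ⌈-Real.logb 2 r⌉₊

/-- Nonzero distances are powers `2 ^ (-k)`, so only the least integer `k ≥ -log₂ r` matters. -/
theorem Ray.dist_le_iff {ξ η : Ray} {r : ℝ} (hr : 0 < r) :
    dist ξ η ≤ r ↔ ξ.vertex (ballLevel r) = η.vertex (ballLevel r) := by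
  have hpow : ∀ k : ℕ, ((1 : ℝ) / 2) ^ k = (2 : ℝ) ^ (-(k : ℝ)) := by
    intro k
    rw [Real.rpow_neg two_pos.le, Real.rpow_natCast]
    simp
  have hlog : (2 : ℝ) ^ Real.logb 2 r = r := Real.rpow_logb two_pos (by norm_num) hr
  rw [Ray.vertex_eq_iff]
  constructor
  · intro h i hi
    have hlt : (i : ℝ) < -Real.logb 2 r := Nat.lt_ceil.1 hi
    refine PiNat.apply_eq_of_dist_lt (E := fun _ => ℕ) (n := i) (lt_of_le_of_lt h ?_) le_rfl
    rw [hpow, ← hlog]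
    exact Real.rpow_lt_rpow_of_exponent_lt (by norm_num) (by linarith)
  · intro h
    have h1 : dist ξ η ≤ (1 / 2) ^ ballLevel r :=
      (PiNat.mem_cylinder_iff_dist_le (E := fun _ => ℕ)).1 (PiNat.mem_cylinder_iff.2 h)
    refine h1.trans ?_
    rw [hpow]
    conv_rhs => rw [← hlog]
    refine Real.rpow_le_rpow_of_exponent_le (by norm_num) ?_
    have := Nat.le_ceil (-Real.logb 2 r)
    unfold ballLevel
    linarith

theorem ballLevel_anti {r R : ℝ} (hr : 0 < r) (h : r ≤ R) : ballLevel R ≤ ballLevel r := by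
  refine Nat.ceil_mono (neg_le_neg ?_)
  exact Real.logb_le_logb_of_le (by norm_num) hr h

theorem coverNumber_le_card_descendants {r R : ℝ} (hr : 0 < r) (h : r ≤ R) (ξ : Ray) :
    coverNumber r (gromovBoundary c ∩ Metric.closedBall ξ R) ≤
      (descendants c (ballLevel r - ballLevel R) (ξ.vertex (ballLevel R))).card := by
  set n := ballLevel R
  set l := ballLevel r - n
  have hk : n + l = ballLevel r := Nat.add_sub_cancel' (ballLevel_anti hr h)
  classical
  -- One centre is chosen in each cylinder; it may lie outside the boundary, since the covering
  -- number is external.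
  have hsec : ∀ w : List ℕ, ∃ η : Ray, (∃ η' : Ray, η'.vertex (n + l) = w) →
      η.vertex (n + l) = w := by
    intro w
    by_cases hw : ∃ η' : Ray, η'.vertex (n + l) = w
    · exact ⟨hw.choose, fun _ => hw.choose_spec⟩
    · exact ⟨fun _ => 0, fun h => absurd h hw⟩
  choose g hg using hsec
  let C : Finset Ray := (descendants c l (ξ.vertex n)).image g
  have hC : Metric.IsCover r.toNNReal (gromovBoundary c ∩ Metric.closedBall ξ R) (C : Set Ray) := by
    rintro η ⟨hη, hηR⟩
    refine ⟨g (η.vertex (n + l)), ?_, ?_⟩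
    · refine Finset.mem_coe.2 (Finset.mem_image_of_mem g ?_)
      have h1 := (Ray.dist_le_iff (hr.trans_le h)).1 (Metric.mem_closedBall.1 hηR)
      change η.vertex n = ξ.vertex n at h1
      rw [← h1]
      exact Ray.vertex_mem_descendants hη n l
    · have h1 := hg (η.vertex (n + l)) ⟨η, rfl⟩
      rw [hk] at h1
      have h2 := (Ray.dist_le_iff hr).2 h1.symm
      change edist _ _ ≤ _
      rw [edist_dist]
      rw [← hk] at h2
      exact ENNReal.ofReal_le_ofReal h2
  have h1 := hC.externalCoveringNumber_le_encard
  rw [Set.encard_coe_eq_coe_finsetCard] at h1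
  have h2 : (C.card : ℕ∞) ≤ ((descendants c l (ξ.vertex n)).card : ℕ∞) := by
    exact_mod_cast Finset.card_image_le
  unfold coverNumber
  have h3 := ENat.toENNReal_mono (h1.trans h2)
  simpa using h3

/-- Each survivor lies on a ray of the boundary, and the centre covering that ray passes through the
same vertex. Distinct survivors therefore need distinct centres. -/
theorem card_survivors_le_coverNumber {r : ℝ} (hr : 0 < r) :
    ((survivors c (ballLevel r) []).card : ℝ≥0∞) ≤ coverNumber r (gromovBoundary c) := by
  classical
  have h0 : ((survivors c (ballLevel r) []).card : ℕ∞) ≤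
      Metric.externalCoveringNumber r.toNNReal (gromovBoundary c) := by
    refine le_iInf₂ fun C hC => ?_
    rw [← Set.encard_coe_eq_coe_finsetCard]
    have hex : ∀ w : List ℕ, w ∈ survivors c (ballLevel r) [] →
        ∃ η ∈ C, η.vertex (ballLevel r) = w := by
      intro w hw
      obtain ⟨hw, hs⟩ := Finset.mem_filter.1 hw
      have hlen := length_of_mem_descendants hw
      simp only [List.length_nil, zero_add] at hlen
      obtain ⟨ξ, hξ, hξw⟩ := exists_ray_through
        (IsVertex.of_mem_descendants (c := c) (v := []) trivial hw) hs
      obtain ⟨η, hη, hd⟩ := hC hξ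
      refine ⟨η, hη, ?_⟩
      change edist ξ η ≤ ENNReal.ofReal r at hd
      rw [edist_dist, ENNReal.ofReal_le_ofReal_iff hr.le, Ray.dist_le_iff hr] at hd
      rw [← hd, ← hlen, hξw]
    have : Nonempty Ray := ⟨fun _ => 0⟩
    choose! g hgC hg using hex
    refine Set.encard_le_encard_of_injOn (f := g) (fun w hw => hgC w hw) ?_
    intro w hw w' hw' heq
    rw [← hg w hw, ← hg w' hw', heq]
  have h3 := ENat.toENNReal_mono h0
  unfold coverNumber
  simpa using h3

end Tree

/-! ### The generating function of the offspring law -/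

/-- The generating function `x ↦ ∑ⱼ θⱼ xʲ`. -/
noncomputable def genFun {N : ℕ} (θ : PMF (Fin (N + 1))) (x : ℝ) : ℝ :=
  ∑ j, (θ j).toReal * x ^ (j : ℕ)

section GenFun

variable {N : ℕ} {θ : PMF (Fin (N + 1))}

theorem sum_toReal_eq_one (θ : PMF (Fin (N + 1))) : ∑ j, (θ j).toReal = 1 := by
  have h := θ.tsum_coe
  rw [tsum_fintype] at h
  rw [← ENNReal.toReal_sum fun j _ => θ.apply_ne_top j, h, ENNReal.toReal_one]

theorem genFun_one (θ : PMF (Fin (N + 1))) : genFun θ 1 = 1 := by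
  simp [genFun, sum_toReal_eq_one]

theorem genFun_nonneg {x : ℝ} (hx : 0 ≤ x) : 0 ≤ genFun θ x :=
  Finset.sum_nonneg fun _ _ => mul_nonneg ENNReal.toReal_nonneg (pow_nonneg hx _)

theorem genFun_mono {x y : ℝ} (hx : 0 ≤ x) (hxy : x ≤ y) : genFun θ x ≤ genFun θ y :=
  Finset.sum_le_sum fun _ _ =>
    mul_le_mul_of_nonneg_left (pow_le_pow_left₀ hx hxy _) ENNReal.toReal_nonneg

theorem convexOn_genFun (θ : PMF (Fin (N + 1))) : ConvexOn ℝ (Ici 0) (genFun θ) := by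
  refine ⟨convex_Ici 0, fun x hx y hy a b ha hb hab => ?_⟩
  simp only [genFun, Finset.smul_sum, ← Finset.sum_add_distrib]
  refine Finset.sum_le_sum fun j _ => ?_
  have := (convexOn_pow (𝕜 := ℝ) (j : ℕ)).2 hx hy ha hb hab
  calc _ ≤ (θ j).toReal * (a • x ^ (j : ℕ) + b • y ^ (j : ℕ)) :=
        mul_le_mul_of_nonneg_left this ENNReal.toReal_nonneg
    _ = _ := by simp only [smul_eq_mul]; ring

theorem hasDerivAt_genFun_one (θ : PMF (Fin (N + 1))) :
    HasDerivAt (genFun θ) (offspringMean θ) 1 := by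
  have h := HasDerivAt.fun_sum (u := Finset.univ) (x := (1 : ℝ))
    fun (j : Fin (N + 1)) _ => (hasDerivAt_pow (j : ℕ) (1 : ℝ)).const_mul (θ j).toReal
  have h2 : genFun θ = fun x => ∑ j, (θ j).toReal * x ^ (j : ℕ) := rfl
  rw [h2]
  simpa [offspringMean] using h

/-- A function with negative derivative at `0` that vanishes there is negative to the right. -/
theorem exists_forall_nonpos_of_hasDerivAt {g : ℝ → ℝ} {d : ℝ} (hg : HasDerivAt g d 0)
    (h0 : g 0 = 0) (hd : d < 0) : ∃ a > 0, a < 1 ∧ ∀ x, 0 ≤ x → x ≤ a → g x ≤ 0 := by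
  have h1 := hasDerivAt_iff_tendsto_slope.1 hg
  have h2 : ∀ᶠ x in 𝓝[>] (0 : ℝ), slope g 0 x < 0 :=
    (h1.mono_left (nhdsWithin_mono _ fun x hx => ne_of_gt hx)).eventually (gt_mem_nhds hd)
  obtain ⟨b, hb, hb'⟩ := mem_nhdsGT_iff_exists_Ioo_subset.1 h2
  have hb : 0 < b := hb
  refine ⟨min (b / 2) (1 / 2), by positivity, by
    exact (min_le_right _ _).trans_lt (by norm_num), fun x hx hxa => ?_⟩
  rcases hx.eq_or_lt with rfl | hx
  · exact h0.le
  have h3 : slope g 0 x < 0 := hb' ⟨hx, by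
    have := hxa.trans (min_le_left _ _); linarith⟩
  rw [slope_def_field, h0, sub_zero, sub_zero, div_lt_iff₀ hx, zero_mul] at h3
  exact h3.le

/-- Both sides equal `1` at `x = 0`, where their derivatives are the mean and `m'`. -/
theorem exists_genFun_exp_le {m' : ℝ} (hm' : offspringMean θ < m') :
    ∃ a > 0, ∀ x, 0 ≤ x → x ≤ a → genFun θ (Real.exp x) ≤ Real.exp (m' * x) := by
  have h1 : HasDerivAt (fun x => genFun θ (Real.exp x) - Real.exp (m' * x))
      (offspringMean θ - m') 0 := by
    have hA : HasDerivAt (fun x => genFun θ (Real.exp x)) (offspringMean θ * Real.exp 0) 0 :=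
      HasDerivAt.comp (h₂ := genFun θ) (0 : ℝ) (by simpa using hasDerivAt_genFun_one θ) (Real.hasDerivAt_exp 0)
    have hB : HasDerivAt (fun x : ℝ => Real.exp (m' * x)) (Real.exp (m' * 0) * (m' * 1)) 0 :=
      ((hasDerivAt_id (0 : ℝ)).const_mul m').exp
    simpa using hA.fun_sub hB
  obtain ⟨a, ha, -, h⟩ := exists_forall_nonpos_of_hasDerivAt h1 (by simp [genFun_one])
    (by linarith)
  exact ⟨a, ha, fun x hx hxa => by simpa using h x hx hxa⟩

theorem exists_genFun_one_sub_le {m' : ℝ} (hm' : m' < offspringMean θ) :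
    ∃ a > 0, a < 1 ∧ ∀ x, 0 ≤ x → x ≤ a → genFun θ (1 - x) ≤ 1 - m' * x := by
  have h1 : HasDerivAt (fun x => genFun θ (1 - x) - (1 - m' * x)) (m' - offspringMean θ) 0 := by
    have hA : HasDerivAt (fun x : ℝ => genFun θ (1 - x)) (offspringMean θ * -1) 0 :=
      HasDerivAt.comp (h₂ := genFun θ) (0 : ℝ) (by simpa using hasDerivAt_genFun_one θ)
        ((hasDerivAt_id (0 : ℝ)).const_sub 1)
    have hB : HasDerivAt (fun x : ℝ => 1 - m' * x) (-(m' * 1)) 0 :=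
      ((hasDerivAt_id (0 : ℝ)).const_mul m').const_sub 1
    exact (hA.fun_sub hB).congr_deriv (by ring)
  obtain ⟨a, ha, ha1, h⟩ := exists_forall_nonpos_of_hasDerivAt h1 (by simp [genFun_one])
    (by linarith)
  exact ⟨a, ha, ha1, fun x hx hxa => by simpa using h x hx hxa⟩

theorem iterate_genFun_nonneg {x : ℝ} (hx : 0 ≤ x) (k : ℕ) : 0 ≤ (genFun θ)^[k] x := by
  induction k with
  | zero => exact hx
  | succ k ih => rw [Function.iterate_succ_apply']; exact genFun_nonneg ih

/-- Each application multiplies the exponent by at most `m'`; starting from `a / m' ^ l` it stays in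
the range `[0, a]` of the one-step bound. -/
theorem iterate_genFun_exp_le {m' a : ℝ} (hm' : 1 < m')
    (h : ∀ x, 0 ≤ x → x ≤ a → genFun θ (Real.exp x) ≤ Real.exp (m' * x)) (ha : 0 < a) (l : ℕ) :
    (genFun θ)^[l] (Real.exp (a / m' ^ l)) ≤ Real.exp a := by
  have hm0 : 0 < m' := by linarith
  have key : ∀ j ≤ l, (genFun θ)^[j] (Real.exp (a / m' ^ l)) ≤ Real.exp (a / m' ^ (l - j)) := by
    intro j hj
    induction j with
    | zero => simp
    | succ j ih =>
      rw [Function.iterate_succ_apply']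
      refine (genFun_mono (iterate_genFun_nonneg (Real.exp_pos _).le _)
        (ih (by omega))).trans ?_
      refine (h _ (by positivity) (div_le_self ha.le (one_le_pow₀ hm'.le))).trans_eq ?_
      congr 1
      rw [show l - j = (l - (j + 1)) + 1 by omega, pow_succ]
      field_simp
  simpa using key l le_rfl

/-- The gap below the fixed point `1` is multiplied by at least `m'` at each step until it reaches
`a`. -/
theorem iterate_genFun_one_sub_le {m' a : ℝ} (hm' : 1 < m') (ha1 : a < 1)
    (h : ∀ x, 0 ≤ x → x ≤ a → genFun θ (1 - x) ≤ 1 - m' * x) {x : ℝ} (hx : 0 ≤ x)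
    (hxa : x ≤ a) (j : ℕ) : (genFun θ)^[j] (1 - x) ≤ 1 - min (m' ^ j * x) a := by
  induction j with
  | zero => simp [hxa]
  | succ j ih =>
    rw [Function.iterate_succ_apply']
    have hn : 0 ≤ min (m' ^ j * x) a := le_min (by positivity) (hx.trans hxa)
    refine (genFun_mono (iterate_genFun_nonneg (by linarith) _) ih).trans ?_
    refine (h _ hn (min_le_right _ _)).trans ?_
    have h2 : min (m' ^ (j + 1) * x) a ≤ m' * min (m' ^ j * x) a := by
      rcases le_total (m' ^ j * x) a with h3 | h3
      · rw [min_eq_left h3, pow_succ', mul_assoc]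
        exact min_le_left _ _
      · rw [min_eq_right h3]
        refine (min_le_right _ _).trans ?_
        nlinarith [hx.trans hxa]
    linarith

/-- Below a point `b` with `genFun θ b < b`, the iterates of the generating function converge
geometrically to the fixed point. -/
theorem exists_iterate_genFun_sub_le {q b : ℝ} (hq : 0 ≤ q) (hqb : q < b)
    (hfix : genFun θ q = q) (hb : genFun θ b < b) :
    ∃ γ, 0 < γ ∧ γ < 1 ∧ ∀ x, q ≤ x → x ≤ b → ∀ j, (genFun θ)^[j] x - q ≤ γ ^ j * (b - q) := by
  -- By convexity the secant slopes from `q` are at most the slope up to `b`, which is below `1`;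
  -- the `1 / 2` only keeps `γ` positive.
  set γ := max ((genFun θ b - q) / (b - q)) (1 / 2)
  have hγ0 : 0 < γ := lt_max_of_lt_right (by norm_num)
  have hγ1 : γ < 1 := max_lt ((div_lt_one (by linarith)).2 (by linarith)) (by norm_num)
  have hcon : ∀ x, q ≤ x → x ≤ b → genFun θ x - q ≤ γ * (x - q) := by
    intro x hx hxb
    rcases hx.eq_or_lt with rfl | hx
    · simp [hfix]
    have h1 := (convexOn_genFun θ).secant_mono (a := q) (x := x) (y := b) hq (hq.trans hx.le)
      (hq.trans hqb.le) hx.ne' hqb.ne' hxb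
    rw [hfix] at h1
    have h2 := h1.trans (le_max_left _ (1 / 2))
    rwa [div_le_iff₀ (by linarith)] at h2
  refine ⟨γ, hγ0, hγ1, fun x hx hxb => ?_⟩
  have key : ∀ j, q ≤ (genFun θ)^[j] x ∧ (genFun θ)^[j] x ≤ b ∧
      (genFun θ)^[j] x - q ≤ γ ^ j * (b - q) := by
    intro j
    induction j with
    | zero => exact ⟨hx, hxb, by simpa using hxb⟩
    | succ j ih =>
      obtain ⟨h1, h2, h3⟩ := ih
      rw [Function.iterate_succ_apply']
      refine ⟨?_, ?_, ?_⟩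
      · exact hfix.symm.le.trans (genFun_mono hq h1)
      · exact (genFun_mono (hq.trans h1) h2).trans hb.le
      · refine (hcon _ h1 h2).trans ?_
        rw [pow_succ', mul_assoc]
        exact mul_le_mul_of_nonneg_left h3 hγ0.le
  exact fun j => (key j).2.2

theorem iterate_genFun_mono {x y : ℝ} (hx : 0 ≤ x) (hxy : x ≤ y) (k : ℕ) :
    (genFun θ)^[k] x ≤ (genFun θ)^[k] y := by
  induction k with
  | zero => exact hxy
  | succ k ih =>
    rw [Function.iterate_succ_apply', Function.iterate_succ_apply']
    exact genFun_mono (iterate_genFun_nonneg hx k) ih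

theorem lt_one_of_le_postfixed (hm : 1 < offspringMean θ) {q : ℝ}
    (hmin : ∀ b, 0 ≤ b → genFun θ b ≤ b → q ≤ b) : q < 1 := by
  obtain ⟨a, ha, ha1, h⟩ := exists_genFun_one_sub_le hm
  have := hmin (1 - a) (by linarith) ((h a ha.le le_rfl).trans (by linarith))
  linarith

/-- Rounding the quotient down costs at most a factor `γ⁻¹` against the geometric series of ratio `γ
^ (1 / (b + 1))`. -/
theorem summable_pow_div {γ : ℝ} (h0 : 0 < γ) (h1 : γ < 1) (b : ℕ) :
    Summable fun k : ℕ => γ ^ (k / (b + 1)) := by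
  have hb : (0 : ℝ) < (b + 1 : ℕ) := by positivity
  set ρ := γ ^ (1 / ((b + 1 : ℕ) : ℝ))
  have hρ0 : 0 ≤ ρ := by positivity
  have hρ1 : ρ < 1 := Real.rpow_lt_one h0.le h1 (by positivity)
  refine Summable.of_nonneg_of_le (fun k => by positivity) (fun k => ?_)
    ((summable_geometric_of_lt_one hρ0 hρ1).mul_left γ⁻¹)
  rw [← Real.rpow_natCast ρ, ← Real.rpow_mul h0.le, ← Real.rpow_neg_one, ← Real.rpow_add h0,
    ← Real.rpow_natCast]
  refine Real.rpow_le_rpow_of_exponent_ge h0 h1.le ?_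
  have h2 : k < (b + 1) * (k / (b + 1) + 1) := by
    have := Nat.lt_mul_div_succ k (Nat.succ_pos b)
    simpa using this
  have h3 : (k : ℝ) ≤ (b + 1 : ℕ) * ((k / (b + 1) : ℕ) + 1 : ℝ) := by exact_mod_cast h2.le
  have h4 : 1 / ((b + 1 : ℕ) : ℝ) * k ≤ ((k / (b + 1) : ℕ) + 1 : ℝ) := by
    rw [one_div, inv_mul_le_iff₀ hb]; exact h3
  linarith

/-- If `q` is the least fixed point of the generating function, the iterates started at distance
`δ / m₁ ^ k` below `1`, where `m₁` is less than the mean, are summably close to `q`. -/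
theorem summable_iterate_genFun_sub {m₁ q δ : ℝ} (hm₁ : 1 < m₁) (hm : m₁ < offspringMean θ)
    (hq : 0 ≤ q) (hfix : genFun θ q = q) (hmin : ∀ b, 0 ≤ b → genFun θ b ≤ b → q ≤ b)
    (hδ : 0 < δ) (hδq : δ ≤ 1 - q) :
    Summable fun k : ℕ => (genFun θ)^[k] (1 - δ / m₁ ^ k) - q := by
  obtain ⟨m', hm₁', hm'⟩ := exists_between hm
  have hm'1 : 1 < m' := hm₁.trans hm₁'
  obtain ⟨a, ha, ha1, h⟩ := exists_genFun_one_sub_le hm'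
  have hfa : genFun θ (1 - a) < 1 - a := by
    have := h a ha.le le_rfl
    nlinarith
  have hqa : q < 1 - a := by
    refine (hmin _ (by linarith) hfa.le).lt_of_ne fun heq => ?_
    rw [← heq, hfix] at hfa
    exact lt_irrefl _ hfa
  obtain ⟨γ, hγ0, hγ1, hγ⟩ := exists_iterate_genFun_sub_le hq hqa hfix hfa
  -- With this `b`, `m' ^ b > m₁ ^ (b + 1)`: a proportion `b / (b + 1)` of the `k` steps suffices to
  -- enlarge the gap `δ' / m₁ ^ k` to `a`. The remaining `k / (b + 1)` steps contract towards `q`.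
  obtain ⟨b, hb⟩ : ∃ b : ℕ, m₁ < (m' / m₁) ^ b :=
    pow_unbounded_of_one_lt _ ((one_lt_div (by linarith)).2 hm₁')
  have hb' : 1 < m' ^ b / m₁ ^ (b + 1) := by
    rw [div_pow, lt_div_iff₀ (by positivity)] at hb
    rw [one_lt_div (by positivity), pow_succ']
    exact hb
  set δ' := min δ a
  have hδ' : 0 < δ' := lt_min hδ ha
  have hev : ∀ᶠ k : ℕ in atTop, a / δ' ≤ (m' ^ b / m₁ ^ (b + 1)) ^ (k / (b + 1)) :=
    ((tendsto_pow_atTop_atTop_of_one_lt hb').comp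
      (Nat.tendsto_div_const_atTop (Nat.succ_ne_zero b))).eventually_ge_atTop _
  refine Summable.of_norm_bounded_eventually_nat
    ((summable_pow_div hγ0 hγ1 b).mul_right (1 - a - q)) ?_
  filter_upwards [hev] with k hk
  have hMk : 1 ≤ m₁ ^ k := one_le_pow₀ hm₁.le
  have hx : δ' / m₁ ^ k ≤ δ' := div_le_self hδ'.le hMk
  have hx0 : 0 < δ' / m₁ ^ k := by positivity
  have hxa : δ' / m₁ ^ k ≤ a := hx.trans (min_le_right _ _)
  have hxδ : δ' / m₁ ^ k ≤ δ / m₁ ^ k :=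
    div_le_div_of_nonneg_right (min_le_left _ _) (by positivity)
  have hδk : δ / m₁ ^ k ≤ δ := div_le_self hδ.le hMk
  have hqfix : ∀ j, (genFun θ)^[j] q = q := fun j => Function.iterate_fixed hfix j
  have hlow : q ≤ (genFun θ)^[k] (1 - δ / m₁ ^ k) := by
    conv_lhs => rw [← hqfix k]
    exact iterate_genFun_mono hq (by linarith) k
  rw [Real.norm_of_nonneg (by linarith)]
  have h1 : (genFun θ)^[k] (1 - δ / m₁ ^ k) ≤ (genFun θ)^[k] (1 - δ' / m₁ ^ k) :=
    iterate_genFun_mono (by linarith) (by linarith) k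
  set i := k / (b + 1)
  set j := k - i
  have hij : i + j = k := Nat.add_sub_cancel' (Nat.div_le_self _ _)
  have hgrow : a ≤ m' ^ j * (δ' / m₁ ^ k) := by
    set r := k % (b + 1)
    have hk' : (b + 1) * i + r = k := Nat.div_add_mod _ _
    have hj : j = b * i + r := by
      have : (b + 1) * i = b * i + i := by ring
      omega
    have h2 : m' ^ j / m₁ ^ k = (m' ^ b / m₁ ^ (b + 1)) ^ i * (m' / m₁) ^ r := by
      rw [hj, ← hk', pow_add, pow_add, pow_mul, pow_mul, div_pow, div_pow, div_mul_div_comm]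
    have h3 : 1 ≤ (m' / m₁) ^ r :=
      one_le_pow₀ ((one_le_div (by linarith)).2 hm₁'.le)
    have h4 : a / δ' ≤ m' ^ j / m₁ ^ k := by
      rw [h2]
      exact hk.trans (le_mul_of_one_le_right (by positivity) h3)
    rw [div_le_iff₀ hδ'] at h4
    calc a ≤ m' ^ j / m₁ ^ k * δ' := h4
      _ = _ := by ring
  have h5 := iterate_genFun_one_sub_le hm'1 ha1 h hx0.le hxa j
  rw [min_eq_right hgrow] at h5
  have h6 : q ≤ (genFun θ)^[j] (1 - δ' / m₁ ^ k) := by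
    conv_lhs => rw [← hqfix j]
    exact iterate_genFun_mono hq (by linarith) j
  have h7 := hγ _ h6 h5 i
  rw [← Function.iterate_add_apply, hij] at h7
  linarith

end GenFun

/-! ### Independence of subtrees -/

section Branching

set_option linter.unusedSectionVars false

variable {N : ℕ} {θ : PMF (Fin (N + 1))} {Ω : Type*} [mΩ : MeasurableSpace Ω] {P : Measure Ω}
  {X : List ℕ → Ω → Fin (N + 1)}

/-- The child counts of the random tree. -/
def childCount (X : List ℕ → Ω → Fin (N + 1)) (ω : Ω) : List ℕ → ℕ := fun u => X u ω

theorem childCount_le (X : List ℕ → Ω → Fin (N + 1)) (ω : Ω) (v : List ℕ) :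
    childCount X ω v ≤ N := Nat.lt_succ_iff.1 (X v ω).is_lt

/-- The `σ`-algebra generated by the offspring variables with label in `S`. -/
@[reducible]
def sigmaOf (X : List ℕ → Ω → Fin (N + 1)) (S : Set (List ℕ)) : MeasurableSpace Ω :=
  ⨆ u ∈ S, MeasurableSpace.comap (X u) inferInstance

/-- The labels in the subtree rooted at `v`. -/
def subtree (v : List ℕ) : Set (List ℕ) := {u | v <:+ u}

theorem sigmaOf_le (hX : ∀ u, Measurable (X u)) (S : Set (List ℕ)) : sigmaOf X S ≤ mΩ :=
  iSup₂_le fun u _ => (hX u).comap_le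

theorem sigmaOf_mono {S T : Set (List ℕ)} (h : S ⊆ T) : sigmaOf X S ≤ sigmaOf X T :=
  biSup_mono h

theorem measurable_sigmaOf {S : Set (List ℕ)} {u : List ℕ} (hu : u ∈ S) :
    Measurable[sigmaOf X S] (X u) :=
  (comap_measurable (X u)).mono (le_iSup₂_of_le u hu le_rfl) le_rfl

theorem subtree_cons_subset (i : ℕ) (v : List ℕ) : subtree (i :: v) ⊆ subtree v :=
  fun _ hu => (List.suffix_cons i v).trans hu

theorem disjoint_subtree_cons {i j : ℕ} (hij : i ≠ j) (v : List ℕ) :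
    Disjoint (subtree (i :: v)) (subtree (j :: v)) := by
  refine Set.disjoint_left.2 fun u hi hj => hij ?_
  have := (List.suffix_of_suffix_length_le hi hj (by simp)).eq_of_length (by simp)
  simpa using this

theorem notMem_subtree_cons (i : ℕ) (v : List ℕ) : v ∉ subtree (i :: v) := by
  intro h
  have := List.IsSuffix.length_le h
  simp at this

theorem lintegral_mul_of_disjoint (hX : ∀ u, Measurable (X u)) (hindep : iIndepFun X P)
    {S T : Set (List ℕ)} (hST : Disjoint S T) {f g : Ω → ℝ≥0∞}
    (hf : Measurable[sigmaOf X S] f) (hg : Measurable[sigmaOf X T] g) :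
    ∫⁻ ω, f ω * g ω ∂P = (∫⁻ ω, f ω ∂P) * ∫⁻ ω, g ω ∂P :=
  lintegral_mul_eq_lintegral_mul_lintegral_of_independent_measurableSpace
    (sigmaOf_le hX S) (sigmaOf_le hX T)
    (indep_iSup_of_disjoint (fun u => (hX u).comap_le) hindep hST) hf hg

theorem lintegral_prod_range [IsProbabilityMeasure P] (hX : ∀ u, Measurable (X u))
    (hindep : iIndepFun X P) {Y : List ℕ → Ω → ℝ≥0∞} {v : List ℕ}
    (hY : ∀ w, Measurable[sigmaOf X (subtree w)] (Y w)) {y : ℝ≥0∞}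
    (hy : ∀ w, ∫⁻ ω, Y w ω ∂P = y) (j : ℕ) :
    Measurable[sigmaOf X (⋃ i < j, subtree (i :: v))]
        (fun ω => ∏ i ∈ Finset.range j, Y (i :: v) ω) ∧
      ∫⁻ ω, ∏ i ∈ Finset.range j, Y (i :: v) ω ∂P = y ^ j := by
  have hmeas : ∀ j, Measurable[sigmaOf X (⋃ i < j, subtree (i :: v))]
      (fun ω => ∏ i ∈ Finset.range j, Y (i :: v) ω) := by
    intro j
    refine Finset.measurable_prod _ fun i hi => ?_
    exact (hY (i :: v)).mono (sigmaOf_mono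
      (Set.subset_biUnion_of_mem (u := fun i => subtree (i :: v)) (Finset.mem_range.1 hi))) le_rfl
  refine ⟨hmeas j, ?_⟩
  induction j with
  | zero => simp
  | succ j ih =>
    simp_rw [Finset.prod_range_succ]
    rw [lintegral_mul_of_disjoint hX hindep ?_ (hmeas j) (hY (j :: v)), ih, hy, pow_succ]
    simp only [Set.disjoint_iUnion_left]
    exact fun i hi => disjoint_subtree_cons hi.ne v

theorem measurable_prod_children {Y : List ℕ → Ω → ℝ≥0∞}
    (hY : ∀ w, Measurable[sigmaOf X (subtree w)] (Y w)) (v : List ℕ) :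
    Measurable[sigmaOf X (subtree v)]
      fun ω => ∏ i ∈ Finset.range (X v ω), Y (i :: v) ω := by
  -- Bounded offspring turns the random range into a fixed one, making measurability visible factor
  -- by factor.
  have h : (fun ω => ∏ i ∈ Finset.range (X v ω), Y (i :: v) ω) =
      fun ω => ∏ i ∈ Finset.range N, if i < (X v ω : ℕ) then Y (i :: v) ω else 1 := by
    funext ω
    rw [← Finset.prod_filter]
    refine Finset.prod_congr ?_ fun _ _ => rfl
    ext i
    have := (X v ω).is_lt
    simp only [Finset.mem_range, Finset.mem_filter]
    omega
  rw [h]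
  refine Finset.measurable_prod _ fun i _ => Measurable.ite ?_ ?_ measurable_const
  · exact measurable_sigmaOf (show v ∈ subtree v from List.suffix_rfl)
      (MeasurableSet.of_discrete (s := {j : Fin (N + 1) | i < (j : ℕ)}))
  · exact (hY (i :: v)).mono (sigmaOf_mono (subtree_cons_subset i v)) le_rfl

theorem measure_offspring_eq (hX : ∀ u, Measurable (X u))
    (hlaw : ∀ u, P.map (X u) = θ.toMeasure) (v : List ℕ) (j : Fin (N + 1)) :
    P (X v ⁻¹' {j}) = θ j := by
  rw [← Measure.map_apply (hX v) (measurableSet_singleton j), hlaw,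
    PMF.toMeasure_apply_singleton _ _ (measurableSet_singleton j)]

/-- The branching property, one generation. -/
theorem lintegral_prod_children [IsProbabilityMeasure P] (hX : ∀ u, Measurable (X u))
    (hlaw : ∀ u, P.map (X u) = θ.toMeasure) (hindep : iIndepFun X P)
    {Y : List ℕ → Ω → ℝ≥0∞} (hY : ∀ w, Measurable[sigmaOf X (subtree w)] (Y w)) {x : ℝ}
    (hx : 0 ≤ x) (hy : ∀ w, ∫⁻ ω, Y w ω ∂P = ENNReal.ofReal x) (v : List ℕ) :
    ∫⁻ ω, ∏ i ∈ Finset.range (X v ω), Y (i :: v) ω ∂P = ENNReal.ofReal (genFun θ x) := by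
  classical
  -- Splitting on the value of `X v` leaves a function of `X v` times a function of the child
  -- subtrees, which are independent.
  have h : ∀ ω, ∏ i ∈ Finset.range (X v ω), Y (i :: v) ω =
      ∑ j : Fin (N + 1), (X v ⁻¹' {j}).indicator 1 ω *
        ∏ i ∈ Finset.range j, Y (i :: v) ω := by
    intro ω
    rw [Finset.sum_eq_single (X v ω)]
    · simp
    · intro j _ hj
      rw [Set.indicator_of_notMem (by simpa using hj.symm), zero_mul]
    · simp
  have hT : ∀ j : ℕ, Measurable (fun ω => ∏ i ∈ Finset.range j, Y (i :: v) ω) := fun j =>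
    (lintegral_prod_range hX hindep hY hy j).1.mono (sigmaOf_le hX _) le_rfl
  have hI : ∀ j : Fin (N + 1),
      Measurable[sigmaOf X {v}] ((X v ⁻¹' {j}).indicator (1 : Ω → ℝ≥0∞)) := fun j =>
    Measurable.indicator (@measurable_const _ _ _ (sigmaOf X {v}) 1)
      (measurable_sigmaOf (Set.mem_singleton v) (measurableSet_singleton j))
  have hIT : ∀ j : Fin (N + 1), Measurable fun ω => (X v ⁻¹' {j}).indicator (1 : Ω → ℝ≥0∞) ω *
      ∏ i ∈ Finset.range j, Y (i :: v) ω := fun j =>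
    ((hI j).mono (sigmaOf_le hX _) le_rfl).mul (hT j)
  simp_rw [h]
  rw [lintegral_finsetSum _ fun j _ => hIT j]
  rw [genFun, ENNReal.ofReal_sum_of_nonneg fun j _ =>
    mul_nonneg ENNReal.toReal_nonneg (pow_nonneg hx _)]
  refine Finset.sum_congr rfl fun j _ => ?_
  rw [lintegral_mul_of_disjoint hX hindep ?_ (hI j) (lintegral_prod_range hX hindep hY hy j).1,
    (lintegral_prod_range hX hindep hY hy j).2,
    lintegral_indicator_one (hX v (measurableSet_singleton j)), measure_offspring_eq hX hlaw,
    ENNReal.ofReal_mul ENNReal.toReal_nonneg, ENNReal.ofReal_toReal (θ.apply_ne_top j),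
    ENNReal.ofReal_pow hx]
  simp only [Set.disjoint_iUnion_right, Set.disjoint_singleton_left]
  exact fun i _ => notMem_subtree_cons i v

theorem measurable_prod_descendants {Y : List ℕ → Ω → ℝ≥0∞}
    (hY : ∀ w, Measurable[sigmaOf X (subtree w)] (Y w)) (k : ℕ) (v : List ℕ) :
    Measurable[sigmaOf X (subtree v)]
      fun ω => ∏ w ∈ descendants (childCount X ω) k v, Y w ω := by
  induction k generalizing v with
  | zero => simpa [descendants] using hY v
  | succ k ih =>
    simp_rw [prod_descendants_succ]
    exact measurable_prod_children ih v

/-- The branching property, `k` generations. -/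
theorem lintegral_prod_descendants [IsProbabilityMeasure P] (hX : ∀ u, Measurable (X u))
    (hlaw : ∀ u, P.map (X u) = θ.toMeasure) (hindep : iIndepFun X P)
    {Y : List ℕ → Ω → ℝ≥0∞} (hY : ∀ w, Measurable[sigmaOf X (subtree w)] (Y w)) {x : ℝ}
    (hx : 0 ≤ x) (hy : ∀ w, ∫⁻ ω, Y w ω ∂P = ENNReal.ofReal x) (k : ℕ) (v : List ℕ) :
    ∫⁻ ω, ∏ w ∈ descendants (childCount X ω) k v, Y w ω ∂P =
      ENNReal.ofReal ((genFun θ)^[k] x) := by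
  induction k generalizing v with
  | zero => simpa [descendants] using hy v
  | succ k ih =>
    simp_rw [prod_descendants_succ]
    rw [Function.iterate_succ_apply']
    exact lintegral_prod_children hX hlaw hindep (measurable_prod_descendants hY k)
      (iterate_genFun_nonneg hx k) ih v

/-! ### The upper tail of the generation sizes -/

/-- Markov's inequality for `exp (t * Z)`, where `Z` is the number of descendants and `t = a / m' ^
l`: its expectation is the `l`-th iterate at `exp t`, hence at most `exp a`. -/
theorem measure_le_card_descendants [IsProbabilityMeasure P] (hX : ∀ u, Measurable (X u))
    (hlaw : ∀ u, P.map (X u) = θ.toMeasure) (hindep : iIndepFun X P) {m' a : ℝ} (hm' : 1 < m')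
    (h : ∀ x, 0 ≤ x → x ≤ a → genFun θ (Real.exp x) ≤ Real.exp (m' * x)) (ha : 0 < a)
    (l : ℕ) (v : List ℕ) (M : ℝ) :
    P {ω | M ≤ (descendants (childCount X ω) l v).card} ≤
      ENNReal.ofReal (Real.exp (a - a / m' ^ l * M)) := by
  set t := a / m' ^ l
  have ht : 0 < t := by positivity
  have h1 := lintegral_prod_descendants hX hlaw hindep (Y := fun _ _ => ENNReal.ofReal (Real.exp t))
    (fun _ => measurable_const) (Real.exp_pos t).le (by simp) l v
  have h2 : ∀ ω, ∏ w ∈ descendants (childCount X ω) l v, ENNReal.ofReal (Real.exp t) =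
      ENNReal.ofReal (Real.exp (t * (descendants (childCount X ω) l v).card)) := by
    intro ω
    rw [Finset.prod_const, ← ENNReal.ofReal_pow (Real.exp_pos t).le, ← Real.exp_nat_mul,
      mul_comm]
  have hmeas := (measurable_prod_descendants (X := X)
    (Y := fun _ _ => ENNReal.ofReal (Real.exp t)) (fun _ => measurable_const) l v).mono
    (sigmaOf_le hX _) le_rfl
  simp_rw [h2] at h1 hmeas
  have h3 : {ω | M ≤ (descendants (childCount X ω) l v).card} ⊆
      {ω | ENNReal.ofReal (Real.exp (t * M)) ≤
        ENNReal.ofReal (Real.exp (t * (descendants (childCount X ω) l v).card))} := by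
    intro ω hω
    refine ENNReal.ofReal_le_ofReal (Real.exp_le_exp.2 ?_)
    exact mul_le_mul_of_nonneg_left hω ht.le
  refine (measure_mono h3).trans ((meas_ge_le_lintegral_div hmeas.aemeasurable
    (ENNReal.ofReal_pos.2 (Real.exp_pos _)).ne' ENNReal.ofReal_ne_top).trans ?_)
  rw [h1, ← ENNReal.ofReal_div_of_pos (Real.exp_pos _), Real.exp_sub]
  exact ENNReal.ofReal_le_ofReal (div_le_div_of_nonneg_right
    (iterate_genFun_exp_le hm' h ha l) (Real.exp_pos _).le)

/-! ### Extinction -/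

open Classical in
/-- The indicator of the event that `v` has no infinite line of descent. -/
noncomputable def extinct (X : List ℕ → Ω → Fin (N + 1)) (v : List ℕ) (ω : Ω) : ℝ≥0∞ :=
  if Survives (childCount X ω) v then 0 else 1

/-- A product of zeros is `1` exactly when the generation is empty, which puts extinction in the
form handled by the branching property. -/
theorem extinct_eq_iSup (v : List ℕ) (ω : Ω) :
    extinct X v ω = ⨆ l, ∏ _w ∈ descendants (childCount X ω) l v, (0 : ℝ≥0∞) := by
  unfold extinct
  split_ifs with h
  · symm
    simp only [ENNReal.iSup_eq_zero, Finset.prod_const]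
    exact fun l => zero_pow (h l).card_pos.ne'
  · obtain ⟨l, hl⟩ := not_forall.1 h
    refine le_antisymm (le_iSup_of_le l ?_) (iSup_le fun l => ?_)
    · rw [Finset.not_nonempty_iff_eq_empty.1 hl]; simp
    · rw [Finset.prod_const]; exact pow_le_one' zero_le_one _

theorem monotone_prod_zero (c : List ℕ → ℕ) (v : List ℕ) :
    Monotone fun l => ∏ _w ∈ descendants c l v, (0 : ℝ≥0∞) := by
  intro l l' hl
  simp only [Finset.prod_const]
  by_cases h : (descendants c l v).Nonempty
  · rw [zero_pow h.card_pos.ne']; exact zero_le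
  · have h' : ¬ (descendants c l' v).Nonempty := fun h' => h (descendants_nonempty_of_le hl h')
    rw [Finset.not_nonempty_iff_eq_empty.1 h, Finset.not_nonempty_iff_eq_empty.1 h']

theorem measurable_extinct (v : List ℕ) : Measurable[sigmaOf X (subtree v)] (extinct X v) := by
  have h : extinct X v =
      fun ω => ⨆ l, ∏ _w ∈ descendants (childCount X ω) l v, (0 : ℝ≥0∞) :=
    funext (extinct_eq_iSup v)
  rw [h]
  exact Measurable.iSup fun l => measurable_prod_descendants (Y := fun _ _ => 0)
    (fun _ => measurable_const) l v

theorem prod_extinct_children (v : List ℕ) (ω : Ω) :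
    ∏ i ∈ Finset.range (X v ω), extinct X (i :: v) ω = extinct X v ω := by
  by_cases h : Survives (childCount X ω) v
  · obtain ⟨i, hi, hs⟩ := h.exists_child
    rw [extinct, if_pos h]
    exact Finset.prod_eq_zero (Finset.mem_range.2 hi) (by simp [extinct, hs])
  · rw [extinct, if_neg h]
    refine Finset.prod_eq_one fun i hi => ?_
    rw [extinct, if_neg fun hs => h (hs.of_child (Finset.mem_range.1 hi))]

/-- The extinction probability is the least fixed point of the generating function. -/
theorem exists_extinction_probability [IsProbabilityMeasure P] (hX : ∀ u, Measurable (X u))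
    (hlaw : ∀ u, P.map (X u) = θ.toMeasure) (hindep : iIndepFun X P) :
    ∃ q, 0 ≤ q ∧ (∀ v, ∫⁻ ω, extinct X v ω ∂P = ENNReal.ofReal q) ∧ genFun θ q = q ∧
      ∀ b, 0 ≤ b → genFun θ b ≤ b → q ≤ b := by
  set Q : ℝ≥0∞ := ⨆ l, ENNReal.ofReal ((genFun θ)^[l] 0)
  have hle : ∀ b, 0 ≤ b → genFun θ b ≤ b → Q ≤ ENNReal.ofReal b := by
    intro b hb hfb
    refine iSup_le fun l => ENNReal.ofReal_le_ofReal ?_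
    induction l with
    | zero => exact hb
    | succ l ih =>
      rw [Function.iterate_succ_apply']
      exact (genFun_mono (iterate_genFun_nonneg le_rfl l) ih).trans hfb
  have hQ : Q ≠ ∞ :=
    ne_top_of_le_ne_top ENNReal.ofReal_ne_top (hle 1 zero_le_one (genFun_one θ).le)
  have hint : ∀ v, ∫⁻ ω, extinct X v ω ∂P = ENNReal.ofReal Q.toReal := by
    intro v
    rw [ENNReal.ofReal_toReal hQ]
    simp_rw [extinct_eq_iSup]
    rw [lintegral_iSup]
    · refine iSup_congr fun l => ?_
      exact lintegral_prod_descendants hX hlaw hindep (Y := fun _ _ => 0)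
        (fun _ => measurable_const) le_rfl (by simp) l v
    · exact fun l => (measurable_prod_descendants (Y := fun _ _ => 0)
        (fun _ => measurable_const) l v).mono (sigmaOf_le hX _) le_rfl
    · exact fun l l' hl ω => monotone_prod_zero _ v hl
  refine ⟨Q.toReal, ENNReal.toReal_nonneg, hint, ?_, fun b hb hfb => ?_⟩
  · have h := lintegral_prod_children hX hlaw hindep (fun w => measurable_extinct (X := X) w)
      ENNReal.toReal_nonneg hint []
    simp_rw [prod_extinct_children, hint] at h
    exact ((ENNReal.ofReal_eq_ofReal_iff ENNReal.toReal_nonneg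
      (genFun_nonneg ENNReal.toReal_nonneg)).1 h).symm
  · have := ENNReal.toReal_mono ENNReal.ofReal_ne_top (hle b hb hfb)
    rwa [ENNReal.toReal_ofReal hb] at this

/-! ### The lower tail of the number of survivors -/

theorem prod_affine_extinct {s t : ℝ≥0∞} (hst : s + t = 1) (k : ℕ) (v : List ℕ) (ω : Ω) :
    ∏ w ∈ descendants (childCount X ω) k v, (s + t * extinct X w ω) =
      s ^ (survivors (childCount X ω) k v).card := by
  classical
  have h : ∀ w, s + t * extinct X w ω = if Survives (childCount X ω) w then s else 1 := by
    intro w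
    unfold extinct
    split_ifs <;> simp [hst]
  simp_rw [h]
  rw [Finset.prod_ite, Finset.prod_const_one, mul_one, Finset.prod_const]
  unfold survivors
  congr! 3

/-- Let `D` be the number of survivors and `s = exp (-M⁻¹)`. Extinction contributes `q` to `E[s ^
D]`, because there `D = 0`; survival with `D ≤ M` contributes at least `exp (-1)` times its
probability. -/
theorem measure_card_survivors_le [IsProbabilityMeasure P] (hX : ∀ u, Measurable (X u))
    (hlaw : ∀ u, P.map (X u) = θ.toMeasure) (hindep : iIndepFun X P) {q : ℝ} (hq : 0 ≤ q)
    (hext : ∀ v, ∫⁻ ω, extinct X v ω ∂P = ENNReal.ofReal q) {M : ℝ} (hM : 0 < M) (k : ℕ) :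
    P {ω | Survives (childCount X ω) [] ∧ (survivors (childCount X ω) k []).card ≤ M} ≤
      ENNReal.ofReal (((genFun θ)^[k] (Real.exp (-M⁻¹) + (1 - Real.exp (-M⁻¹)) * q) - q) *
        Real.exp 1) := by
  set s := Real.exp (-M⁻¹)
  have hs0 : 0 < s := Real.exp_pos _
  have hs1 : s ≤ 1 := Real.exp_le_one_iff.2 (by simpa using hM.le)
  set Y : List ℕ → Ω → ℝ≥0∞ := fun v ω =>
    ENNReal.ofReal s + ENNReal.ofReal (1 - s) * extinct X v ω
  have hst : ENNReal.ofReal s + ENNReal.ofReal (1 - s) = 1 := by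
    rw [← ENNReal.ofReal_add hs0.le (by linarith)]; simp
  have hYm : ∀ w, Measurable[sigmaOf X (subtree w)] (Y w) := fun w =>
    ((measurable_extinct w).const_mul _).const_add _
  have hextm : ∀ w, Measurable (extinct X w) := fun w =>
    (measurable_extinct w).mono (sigmaOf_le hX _) le_rfl
  have hYi : ∀ w, ∫⁻ ω, Y w ω ∂P = ENNReal.ofReal (s + (1 - s) * q) := by
    intro w
    rw [lintegral_add_left measurable_const, lintegral_const_mul _ (hextm w), hext,
      ENNReal.ofReal_add hs0.le (mul_nonneg (by linarith) hq), ENNReal.ofReal_mul (by linarith)]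
    simp
  have h1 := lintegral_prod_descendants hX hlaw hindep hYm
    (add_nonneg hs0.le (mul_nonneg (by linarith) hq)) hYi k []
  have hm1 := (measurable_prod_descendants hYm k []).mono (sigmaOf_le hX _) le_rfl
  simp only [Y, prod_affine_extinct hst] at h1 hm1
  set D : Ω → ℕ := fun ω => (survivors (childCount X ω) k []).card
  set c := ENNReal.ofReal (Real.exp (-1))
  have hc : c ≠ 0 := (ENNReal.ofReal_pos.2 (Real.exp_pos _)).ne'
  -- A set containing the event, described by functions already known to be measurable.
  set A : Set Ω := {ω | extinct X [] ω = 0} ∩ {ω | c ≤ ENNReal.ofReal s ^ D ω}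
  have hA : MeasurableSet A :=
    (hextm [] (measurableSet_singleton 0)).inter (measurableSet_le measurable_const hm1)
  have hsub : {ω | Survives (childCount X ω) [] ∧ (D ω : ℝ) ≤ M} ⊆ A := by
    rintro ω ⟨hω, hD⟩
    refine ⟨by simp [extinct, hω], ?_⟩
    change c ≤ ENNReal.ofReal s ^ D ω
    rw [← ENNReal.ofReal_pow hs0.le, ← Real.exp_nat_mul]
    refine ENNReal.ofReal_le_ofReal (Real.exp_le_exp.2 ?_)
    rw [mul_neg, neg_le_neg_iff, ← div_eq_mul_inv]
    exact (div_le_one hM).2 hD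
  have hpt : ∀ ω, extinct X [] ω + A.indicator (fun _ => c) ω ≤ ENNReal.ofReal s ^ D ω := by
    intro ω
    by_cases hω : ω ∈ A
    · rw [Set.indicator_of_mem hω, show extinct X [] ω = 0 from hω.1, zero_add]
      exact hω.2
    · rw [Set.indicator_of_notMem hω, add_zero]
      by_cases hS : Survives (childCount X ω) []
      · simp [extinct, hS]
      · have : D ω = 0 := by
          classical
          rw [Finset.card_eq_zero]
          exact Finset.filter_eq_empty_iff.2 fun w hw hs => hS (hs.of_mem_descendants hw)
        simp [extinct, hS, this]
  have h2 : ENNReal.ofReal q + c * P A ≤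
      ENNReal.ofReal ((genFun θ)^[k] (s + (1 - s) * q)) := by
    rw [← h1, ← hext [], ← lintegral_indicator_const hA c, ← lintegral_add_left (hextm [])]
    exact lintegral_mono hpt
  refine (measure_mono hsub).trans ?_
  have h3 : c * P A ≤ ENNReal.ofReal ((genFun θ)^[k] (s + (1 - s) * q) - q) := by
    rw [ENNReal.ofReal_sub _ hq]
    exact ENNReal.le_sub_of_add_le_left ENNReal.ofReal_ne_top h2
  have h4 : P A = c * P A * ENNReal.ofReal (Real.exp 1) := by
    rw [mul_comm c, mul_assoc, ← ENNReal.ofReal_mul (Real.exp_pos _).le, ← Real.exp_add]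
    simp
  rw [h4, ENNReal.ofReal_mul' (Real.exp_pos _).le]
  gcongr

end Branching

/-! ### Almost sure growth -/

section Growth

variable {N : ℕ} {θ : PMF (Fin (N + 1))} {Ω : Type*} [MeasurableSpace Ω] {P : Measure Ω}
  [IsProbabilityMeasure P] {X : List ℕ → Ω → Fin (N + 1)}

/-- On survival, the number of survivors at level `k` exceeds `m₁ ^ k` if `m₁` is less than
the mean. -/
theorem ae_pow_lt_card_survivors (hX : ∀ u, Measurable (X u))
    (hlaw : ∀ u, P.map (X u) = θ.toMeasure) (hindep : iIndepFun X P) {m₁ : ℝ} (hm₁ : 1 < m₁)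
    (hm : m₁ < offspringMean θ) :
    ∀ᵐ ω ∂P, Survives (childCount X ω) [] →
      ∀ᶠ k in atTop, m₁ ^ k < (survivors (childCount X ω) k []).card := by
  obtain ⟨q, hq, hext, hfix, hmin⟩ := exists_extinction_probability hX hlaw hindep
  have hq1 : q < 1 := lt_one_of_le_postfixed (hm₁.trans hm) hmin
  have hsum := (summable_iterate_genFun_sub hm₁ hm hq hfix hmin
    (δ := (1 - q) / 2) (by linarith) (by linarith)).mul_right (Real.exp 1)
  have hbc : ∑' k : ℕ, P {ω | Survives (childCount X ω) [] ∧
      (survivors (childCount X ω) k []).card ≤ m₁ ^ k} ≠ ∞ := by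
    refine ne_top_of_le_ne_top hsum.tsum_ofReal_ne_top (ENNReal.tsum_le_tsum fun k => ?_)
    have hM : 1 ≤ m₁ ^ k := one_le_pow₀ hm₁.le
    have hM0 : 0 < m₁ ^ k := by linarith
    refine (measure_card_survivors_le hX hlaw hindep hq hext hM0 k).trans ?_
    refine ENNReal.ofReal_le_ofReal (mul_le_mul_of_nonneg_right ?_ (Real.exp_pos _).le)
    refine sub_le_sub_right (iterate_genFun_mono ?_ ?_ k) q
    · have : Real.exp (-(m₁ ^ k)⁻¹) ≤ 1 := Real.exp_le_one_iff.2 (by simpa using hM0.le)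
      have := mul_nonneg (sub_nonneg.2 this) hq
      positivity
    · set u := (m₁ ^ k)⁻¹
      have hu0 : 0 < u := inv_pos.2 hM0
      have hu1 : u ≤ 1 := inv_le_one_of_one_le₀ hM
      have h1 : Real.exp (-u) * (1 + u) ≤ 1 := by
        have h2 := mul_le_mul_of_nonneg_left (Real.add_one_le_exp u) (Real.exp_pos (-u)).le
        rw [← Real.exp_add, neg_add_cancel, Real.exp_zero] at h2
        linarith
      -- Since `s + (1 - s) * q = 1 - (1 - s) * (1 - q)`, this is what produces `δ = (1 - q) / 2`.
      have h3 : Real.exp (-u) ≤ 1 - u / 2 := by nlinarith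
      rw [div_eq_mul_inv]
      change _ ≤ 1 - (1 - q) / 2 * u
      nlinarith
  filter_upwards [ae_eventually_notMem hbc] with ω hω hS
  filter_upwards [hω] with k hk
  by_contra! h
  exact hk ⟨hS, h⟩

theorem summable_exp_sub_pow {a y z A B : ℝ} (ha : 0 < a) (hy : 1 ≤ y) (hz : y < z) :
    Summable fun l : ℕ => Real.exp (A * y ^ l + B - a * z ^ l) := by
  have hz1 : 1 < z := hy.trans_lt hz
  have hz0 : 0 < z := by linarith
  refine Summable.of_norm_bounded_eventually_nat Real.summable_exp_neg_nat ?_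
  have h1 : Tendsto (fun l : ℕ => A * (y / z) ^ l + B * (1 / z) ^ l + (l : ℝ) ^ 1 / z ^ l) atTop
      (𝓝 (A * 0 + B * 0 + 0)) := by
    refine Tendsto.add (Tendsto.add (Tendsto.const_mul _ ?_) (Tendsto.const_mul _ ?_))
      (tendsto_pow_const_div_const_pow_of_one_lt 1 hz1)
    · exact tendsto_pow_atTop_nhds_zero_of_lt_one (by positivity) ((div_lt_one hz0).2 hz)
    · exact tendsto_pow_atTop_nhds_zero_of_lt_one (by positivity) ((div_lt_one hz0).2 hz1)
  filter_upwards [h1.eventually (gt_mem_nhds (show A * 0 + B * 0 + 0 < a by simpa using ha))]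
    with l hl
  rw [Real.norm_of_nonneg (Real.exp_pos _).le]
  refine Real.exp_le_exp.2 ?_
  have hzl : 0 < z ^ l := by positivity
  have h2 : A * y ^ l + B + l = (A * (y / z) ^ l + B * (1 / z) ^ l + (l : ℝ) ^ 1 / z ^ l) * z ^ l := by
    rw [div_pow, div_pow]
    field_simp
    simp
  have h3 := mul_lt_mul_of_pos_right hl hzl
  linarith

/-- All vertices of level at most `C * y ^ l` have fewer than `b ^ l` descendants `l` levels
below, if `b` exceeds `y` times the mean and `l` is large. -/
theorem ae_card_descendants_lt (hX : ∀ u, Measurable (X u))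
    (hlaw : ∀ u, P.map (X u) = θ.toMeasure) (hindep : iIndepFun X P)
    (hm : 1 < offspringMean θ) {C y b : ℝ} (hC : 0 ≤ C) (hy : 1 ≤ y)
    (hb : offspringMean θ * y < b) :
    ∀ᵐ ω ∂P, ∀ᶠ l : ℕ in atTop, ∀ n : ℕ, (n : ℝ) ≤ C * y ^ l →
      ∀ v ∈ descendants (fun _ => N) n [], (descendants (childCount X ω) l v).card < b ^ l := by
  have hy0 : 0 < y := by linarith
  obtain ⟨m', hm', hm'b⟩ := exists_between ((lt_div_iff₀ hy0).2 hb)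
  have hm'1 : 1 < m' := hm.trans hm'
  have hm'0 : 0 < m' := by linarith
  obtain ⟨a, ha, hexp⟩ := exists_genFun_exp_le hm'
  have hz : y < b / m' := by
    rw [lt_div_iff₀ hy0] at hm'b
    rw [lt_div_iff₀ hm'0]
    linarith
  -- The union runs over the full `N`-ary tree, so that its index set is not random.
  have hbc : ∑' l : ℕ, P (⋃ n ∈ Finset.range (⌊C * y ^ l⌋₊ + 1),
      ⋃ v ∈ descendants (fun _ => N) n [],
        {ω | b ^ l ≤ (descendants (childCount X ω) l v).card}) ≠ ∞ := by
    have hsum := summable_exp_sub_pow (A := Real.log (N + 2) * C) (B := Real.log (N + 2) + a)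
      ha hy hz
    refine ne_top_of_le_ne_top hsum.tsum_ofReal_ne_top (ENNReal.tsum_le_tsum fun l => ?_)
    set K := ⌊C * y ^ l⌋₊ + 1
    set p := Real.exp (a - a / m' ^ l * b ^ l)
    have h1 : P (⋃ n ∈ Finset.range K, ⋃ v ∈ descendants (fun _ => N) n [],
        {ω | b ^ l ≤ (descendants (childCount X ω) l v).card}) ≤
        ∑ n ∈ Finset.range K, ∑ v ∈ descendants (fun _ => N) n [], ENNReal.ofReal p := by
      refine (measure_biUnion_finset_le _ _).trans (Finset.sum_le_sum fun n _ => ?_)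
      refine (measure_biUnion_finset_le _ _).trans (Finset.sum_le_sum fun v _ => ?_)
      exact measure_le_card_descendants hX hlaw hindep hm'1 hexp ha l v _
    -- The base `N + 2` is at least `2`, as the bound on the geometric sum requires.
    have h2 : ∑ n ∈ Finset.range K, (descendants (fun _ => N) n []).card ≤ (N + 2) ^ K := by
      refine (Finset.sum_le_sum fun n _ => ((card_descendants_le (fun _ => le_rfl) n []).trans
        (Nat.pow_le_pow_left (show N ≤ N + 2 by omega) n))).trans ?_
      exact (Nat.geomSum_lt (by omega) fun n hn => Finset.mem_range.1 hn).le
    refine h1.trans ?_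
    simp only [Finset.sum_const, nsmul_eq_mul, ← Finset.sum_mul]
    rw [← Nat.cast_sum]
    have h3 : (((∑ n ∈ Finset.range K, (descendants (fun _ => N) n []).card : ℕ)) : ℝ≥0∞) ≤
        ENNReal.ofReal ((N + 2 : ℝ) ^ K) := by
      have h4 : ((N + 2 : ℝ) ^ K) = (((N + 2) ^ K : ℕ) : ℝ) := by push_cast; rfl
      rw [h4, ENNReal.ofReal_natCast]
      exact_mod_cast h2
    refine (mul_le_mul_left h3 _).trans ?_
    rw [← ENNReal.ofReal_mul (by positivity)]
    refine ENNReal.ofReal_le_ofReal ?_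
    have hN : (0 : ℝ) < N + 2 := by positivity
    have hlogN : 0 ≤ Real.log (N + 2) := Real.log_nonneg (by
      have : (0 : ℝ) ≤ N := Nat.cast_nonneg N
      linarith)
    rw [← Real.exp_log (pow_pos hN K), Real.log_pow, ← Real.exp_add]
    refine Real.exp_le_exp.2 ?_
    have hK : (K : ℝ) ≤ C * y ^ l + 1 := by
      have := Nat.floor_le (show 0 ≤ C * y ^ l by positivity)
      push_cast [K]
      linarith
    have h5 : a / m' ^ l * b ^ l = a * (b / m') ^ l := by rw [div_pow]; ring
    have h6 := mul_le_mul_of_nonneg_right hK hlogN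
    rw [h5]
    linarith
  filter_upwards [ae_eventually_notMem hbc] with ω hω
  filter_upwards [hω] with l hl n hn v hv
  by_contra! h
  refine hl ?_
  simp only [Set.mem_iUnion]
  exact ⟨n, Finset.mem_range.2 (Nat.lt_succ_iff.2 (Nat.le_floor hn)), v, hv, h⟩

/-- On survival, generation sizes and numbers of survivors have exponential growth rate
`log m`. -/
theorem ae_tendsto_log_card (hX : ∀ u, Measurable (X u))
    (hlaw : ∀ u, P.map (X u) = θ.toMeasure) (hindep : iIndepFun X P)
    (hm : 1 < offspringMean θ) :
    ∀ᵐ ω ∂P, Survives (childCount X ω) [] →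
      (∀ᶠ k in atTop, 0 < (survivors (childCount X ω) k []).card) ∧
      Tendsto (fun k : ℕ => Real.log (survivors (childCount X ω) k []).card / k) atTop
        (𝓝 (Real.log (offspringMean θ))) ∧
      Tendsto (fun k : ℕ => Real.log (descendants (childCount X ω) k []).card / k) atTop
        (𝓝 (Real.log (offspringMean θ))) := by
  have hm0 : 0 < offspringMean θ := by linarith
  -- Rational rates keep the exceptional null sets countable in number.
  have hlow : ∀ᵐ ω ∂P, ∀ p : ℚ, 1 < (p : ℝ) → (p : ℝ) < offspringMean θ →
      Survives (childCount X ω) [] →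
        ∀ᶠ k in atTop, (p : ℝ) ^ k < (survivors (childCount X ω) k []).card := by
    refine ae_all_iff.2 fun p => ?_
    by_cases h : 1 < (p : ℝ) ∧ (p : ℝ) < offspringMean θ
    · filter_upwards [ae_pow_lt_card_survivors hX hlaw hindep h.1 h.2] with ω hω _ _ using hω
    · exact Eventually.of_forall fun ω h1 h2 => absurd ⟨h1, h2⟩ h
  have hup : ∀ᵐ ω ∂P, ∀ p : ℚ, offspringMean θ < (p : ℝ) →
      ∀ᶠ k in atTop, (descendants (childCount X ω) k []).card < (p : ℝ) ^ k := by
    refine ae_all_iff.2 fun p => ?_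
    by_cases h : offspringMean θ < (p : ℝ)
    · filter_upwards [ae_card_descendants_lt hX hlaw hindep hm (C := 0) (y := 1) le_rfl le_rfl
        (b := p) (by simpa using h)] with ω hω _
      filter_upwards [hω] with k hk
      exact hk 0 (by simp) [] (by simp [descendants])
    · exact Eventually.of_forall fun ω h1 => absurd h1 h
  filter_upwards [hlow, hup] with ω hlow hup hS
  set D : ℕ → ℕ := fun k => (survivors (childCount X ω) k []).card
  set Z : ℕ → ℕ := fun k => (descendants (childCount X ω) k []).card
  have hDZ : ∀ k, D k ≤ Z k := fun k => by classical exact Finset.card_filter_le _ _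
  have hpos : ∀ᶠ k in atTop, 0 < D k := by
    obtain ⟨p, hp1, hp⟩ := exists_rat_btwn hm
    filter_upwards [hlow p hp1 hp hS] with k hk
    have : (0 : ℝ) < D k := (pow_pos (by linarith) k).trans hk
    exact_mod_cast this
  have hlog : ∀ a < Real.log (offspringMean θ), ∀ᶠ k : ℕ in atTop, a < Real.log (D k) / k := by
    intro a ha
    have h1 : max 1 (Real.exp a) < offspringMean θ :=
      max_lt hm ((Real.lt_log_iff_exp_lt hm0).1 ha)
    obtain ⟨p, hp1, hp⟩ := exists_rat_btwn h1
    have hp0 : 1 < (p : ℝ) := (le_max_left _ _).trans_lt hp1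
    have hpa : a < Real.log p :=
      (Real.lt_log_iff_exp_lt (by linarith)).2 ((le_max_right _ _).trans_lt hp1)
    filter_upwards [hlow p hp0 hp hS, eventually_gt_atTop 0] with k hk hk0
    have hk0' : (0 : ℝ) < k := by exact_mod_cast hk0
    have h2 := Real.log_lt_log (pow_pos (by linarith) k) hk
    rw [Real.log_pow] at h2
    rw [lt_div_iff₀ hk0']
    nlinarith
  have hlog' : ∀ b > Real.log (offspringMean θ), ∀ᶠ k : ℕ in atTop, Real.log (Z k) / k < b := by
    intro b hb
    obtain ⟨p, hp1, hp⟩ := exists_rat_btwn ((Real.log_lt_iff_lt_exp hm0).1 hb)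
    have hp0 : 0 < (p : ℝ) := by linarith
    filter_upwards [hup p hp1, hpos, eventually_gt_atTop 0] with k hk hD hk0
    have hk0' : (0 : ℝ) < k := by exact_mod_cast hk0
    have hZ : (0 : ℝ) < Z k := by exact_mod_cast hD.trans_le (hDZ k)
    have h2 := Real.log_lt_log hZ hk
    rw [Real.log_pow] at h2
    have h3 := (Real.log_lt_iff_lt_exp hp0).2 hp
    rw [div_lt_iff₀ hk0']
    nlinarith
  have hle : ∀ᶠ k : ℕ in atTop, Real.log (D k) / k ≤ Real.log (Z k) / k := by
    filter_upwards [hpos] with k hk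
    refine div_le_div_of_nonneg_right (Real.log_le_log (by exact_mod_cast hk) ?_)
      (Nat.cast_nonneg k)
    exact_mod_cast hDZ k
  refine ⟨hpos, tendsto_order.2 ⟨hlog, fun b hb => ?_⟩, tendsto_order.2 ⟨fun a ha => ?_, hlog'⟩⟩
  · filter_upwards [hle, hlog' b hb] with k h1 h2 using h1.trans_lt h2
  · filter_upwards [hle, hlog a ha] with k h1 h2 using h2.trans_le h1

end Growth

/-! ### Box dimension -/

theorem tendsto_neg_log_nhdsGT_zero : Tendsto (fun r => -Real.log r) (𝓝[>] 0) atTop :=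
  tendsto_neg_atBot_atTop.comp Real.tendsto_log_nhdsGT_zero

theorem tendsto_neg_logb_nhdsGT_zero : Tendsto (fun r => -Real.logb 2 r) (𝓝[>] 0) atTop := by
  have h := tendsto_neg_log_nhdsGT_zero.atTop_div_const (Real.log_pos one_lt_two)
  refine h.congr fun r => ?_
  rw [Real.logb, neg_div]

theorem hasBoxDim_gromovBoundary {c : List ℕ → ℕ} {L : ℝ}
    (hpos : ∀ᶠ k in atTop, 0 < (survivors c k []).card)
    (hD : Tendsto (fun k : ℕ => Real.log (survivors c k []).card / k) atTop (𝓝 L))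
    (hZ : Tendsto (fun k : ℕ => Real.log (descendants c k []).card / k) atTop (𝓝 L)) :
    HasBoxDim (gromovBoundary c) (L / Real.log 2) := by
  have hlev : Tendsto ballLevel (𝓝[>] 0) atTop :=
    tendsto_nat_ceil_atTop.comp tendsto_neg_logb_nhdsGT_zero
  have hratio : Tendsto (fun r => (ballLevel r : ℝ) / -Real.log r) (𝓝[>] 0)
      (𝓝 (1 / Real.log 2)) := by
    have h1 := ((tendsto_nat_ceil_div_atTop (R := ℝ)).comp
      tendsto_neg_logb_nhdsGT_zero).div_const (Real.log 2)
    refine h1.congr fun r => ?_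
    have h2 : -Real.log r = -Real.logb 2 r * Real.log 2 := by
      rw [Real.logb]; field_simp [(Real.log_pos one_lt_two).ne']
    rw [h2, ← div_div]
    rfl
  have hsmall : ∀ᶠ r : ℝ in 𝓝[>] 0, 0 < r ∧ r < 1 := Ioo_mem_nhdsGT one_pos
  have hupper : ∀ r : ℝ, 0 < r → r < 1 →
      coverNumber r (gromovBoundary c) ≤ (descendants c (ballLevel r) []).card := by
    intro r hr hr1
    have h0 : ballLevel 1 = 0 := by simp [ballLevel]
    obtain ⟨ξ⟩ : Nonempty Ray := ⟨fun _ => 0⟩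
    have h1 := coverNumber_le_card_descendants (c := c) hr hr1.le ξ
    have h2 : gromovBoundary c ∩ Metric.closedBall ξ 1 = gromovBoundary c := by
      refine Set.inter_eq_left.2 fun η _ => ?_
      rw [Metric.mem_closedBall, Ray.dist_le_iff one_pos, h0]
      rfl
    rw [h2, h0] at h1
    exact h1
  set n : ℝ → ℝ := fun r => (coverNumber r (gromovBoundary c)).toReal
  have hn : ∀ᶠ r : ℝ in 𝓝[>] 0, 0 < ((survivors c (ballLevel r) []).card : ℝ) ∧
      ((survivors c (ballLevel r) []).card : ℝ) ≤ n r ∧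
      n r ≤ (descendants c (ballLevel r) []).card ∧
      coverNumber r (gromovBoundary c) = ENNReal.ofReal (n r) := by
    filter_upwards [hsmall, hlev.eventually hpos] with r hr hp
    have h1 := hupper r hr.1 hr.2
    have htop : coverNumber r (gromovBoundary c) ≠ ∞ :=
      ne_top_of_le_ne_top (ENNReal.natCast_ne_top _) h1
    refine ⟨by exact_mod_cast hp, ?_, ?_, (ENNReal.ofReal_toReal htop).symm⟩
    · simpa using ENNReal.toReal_mono htop (card_survivors_le_coverNumber (c := c) hr.1)
    · simpa using ENNReal.toReal_mono (ENNReal.natCast_ne_top _) h1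
  have hlim : Tendsto (fun r => Real.log (n r) / ballLevel r) (𝓝[>] 0) (𝓝 L) := by
    refine tendsto_of_tendsto_of_tendsto_of_le_of_le' (hD.comp hlev) (hZ.comp hlev) ?_ ?_
    · filter_upwards [hn] with r hr
      exact div_le_div_of_nonneg_right (Real.log_le_log hr.1 hr.2.1) (Nat.cast_nonneg _)
    · filter_upwards [hn] with r hr
      exact div_le_div_of_nonneg_right (Real.log_le_log (hr.1.trans_le hr.2.1) hr.2.2.1)
        (Nat.cast_nonneg _)
  have hreal : Tendsto (fun r => Real.log (n r) / -Real.log r) (𝓝[>] 0)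
      (𝓝 (L / Real.log 2)) := by
    have h1 := hlim.mul hratio
    rw [mul_one_div] at h1
    refine h1.congr' ?_
    filter_upwards [hlev.eventually_gt_atTop 0] with r hr
    have : (ballLevel r : ℝ) ≠ 0 := by exact_mod_cast hr.ne'
    exact div_mul_div_cancel₀ this
  refine ((continuous_coe_real_ereal.tendsto _).comp hreal).congr' ?_
  filter_upwards [hn] with r hr
  rw [hr.2.2.2, ENNReal.log_ofReal_of_pos (hr.1.trans_le hr.2.1)]
  exact EReal.coe_div _ _

/-! ### The `φ`-Assouad dimension -/

section Scales

variable {φ : ℝ → ℝ} {r R : ℝ}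

theorem neg_logb_eq_of_eq_rpow (hR : 0 < R) (hrR : r = R ^ (1 + φ R)) :
    -Real.logb 2 r = (1 + φ R) * -Real.logb 2 R := by
  rw [hrR, Real.logb_rpow_eq_mul_logb_of_pos hR]
  ring

theorem neg_logb_pos (hR : 0 < R) (hR1 : R < 1) : 0 < -Real.logb 2 R :=
  neg_pos.2 (Real.logb_neg one_lt_two hR hR1)

/-- Two ceilings are subtracted, each exceeding its argument by less than `1`. -/
theorem abs_ballLevel_sub_sub_lt (hr : 0 < r) (hrR : r = R ^ (1 + φ R)) (hlt : r < R)
    (hR1 : R < 1) :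
    |((ballLevel r - ballLevel R : ℕ) : ℝ) - φ R * -Real.logb 2 R| < 1 := by
  have hR : 0 < R := hr.trans hlt
  have h1 := neg_logb_eq_of_eq_rpow (φ := φ) hR hrR
  have hL := neg_logb_pos hR hR1
  have hL' := neg_logb_pos hr (hlt.trans hR1)
  have h2 : (ballLevel R : ℝ) < -Real.logb 2 R + 1 := Nat.ceil_lt_add_one hL.le
  have h3 : -Real.logb 2 R ≤ ballLevel R := Nat.le_ceil _
  have h4 : (ballLevel r : ℝ) < -Real.logb 2 r + 1 := Nat.ceil_lt_add_one hL'.le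
  have h5 : -Real.logb 2 r ≤ ballLevel r := Nat.le_ceil _
  rw [Nat.cast_sub (ballLevel_anti hr hlt.le), abs_lt]
  constructor <;> linarith

theorem rpow_ballLevel_sub_le (hr : 0 < r) (hrR : r = R ^ (1 + φ R)) (hlt : r < R)
    (hR1 : R < 1) {s : ℝ} (hs : 0 ≤ s) :
    ((2 : ℝ) ^ s) ^ (ballLevel r - ballLevel R) ≤ 2 ^ s * (R / r) ^ s := by
  have hR : 0 < R := hr.trans hlt
  have h1 := neg_logb_eq_of_eq_rpow (φ := φ) hR hrR
  have h2 := (abs_lt.1 (abs_ballLevel_sub_sub_lt hr hrR hlt hR1)).2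
  have h3 : R / r = 2 ^ (Real.logb 2 (R / r)) :=
    (Real.rpow_logb two_pos (by norm_num) (by positivity)).symm
  rw [h3, ← Real.rpow_natCast, ← Real.rpow_mul two_pos.le, ← Real.rpow_mul two_pos.le,
    ← Real.rpow_add two_pos]
  refine Real.rpow_le_rpow_of_exponent_le one_le_two ?_
  rw [Real.logb_div hR.ne' hr.ne']
  nlinarith

/-- Under the growth condition on `φ`, a ball of radius `R` is a cylinder of level at most
exponential in the number of levels between `R` and `R ^ (1 + φ R)`. -/
theorem exists_ballLevel_le {m ε : ℝ} (hm : 1 < m) (hε : 0 < ε)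
    (hφ_gt : ∀ᶠ x in 𝓝[>] (0 : ℝ),
      Real.log |Real.log x| / |Real.log x| * (ε * Real.log m)⁻¹ < φ x) :
    ∃ C, 0 ≤ C ∧ ∀ r R : ℝ, 0 < r → r = R ^ (1 + φ R) → r < R → R < 1 →
      (ballLevel R : ℝ) ≤ C * (m ^ ε) ^ (ballLevel r - ballLevel R) := by
  obtain ⟨δ, hδ, hδφ⟩ := mem_nhdsGT_iff_exists_Ioo_subset.1 hφ_gt
  have hδ : 0 < δ := hδ
  have hm0 : 0 < m := by linarith
  set y := m ^ ε
  have hy : 1 ≤ y := Real.one_le_rpow hm.le hε.le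
  have hy0 : 0 < y := by linarith
  have hlog2 : 0 < Real.log 2 := Real.log_pos one_lt_two
  have hεm : 0 < ε * Real.log m := mul_pos hε (Real.log_pos hm)
  -- The first term serves `R < δ`, where the hypothesis on `φ` yields `-log R < y ^ (l + 1)`; the
  -- `1` absorbs the ceiling; the last term serves `R ≥ δ`.
  refine ⟨y / Real.log 2 + 1 + |Real.logb 2 δ|, by positivity, fun r R hr hrR hlt hR1 => ?_⟩
  have hR : 0 < R := hr.trans hlt
  set l := ballLevel r - ballLevel R
  have hyl : 1 ≤ y ^ l := one_le_pow₀ hy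
  have hL := neg_logb_pos hR hR1
  have hceil : (ballLevel R : ℝ) < -Real.logb 2 R + 1 := Nat.ceil_lt_add_one hL.le
  have hlogR : -Real.log R = -Real.logb 2 R * Real.log 2 := by
    rw [Real.logb]; field_simp
  rcases lt_or_ge R δ with hRδ | hRδ
  · have h1 : Real.log |Real.log R| / |Real.log R| * (ε * Real.log m)⁻¹ < φ R := hδφ ⟨hR, hRδ⟩
    have hlogneg : Real.log R < 0 := Real.log_neg hR hR1
    rw [abs_of_neg hlogneg, mul_inv_lt_iff₀ hεm, div_lt_iff₀ (by linarith)] at h1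
    have h2 := (abs_lt.1 (abs_ballLevel_sub_sub_lt hr hrR hlt hR1)).1
    have h3 : φ R * -Real.logb 2 R ≤ l + 1 := by linarith
    have hlog21 : Real.log 2 ≤ 1 := by linarith [Real.log_two_lt_d9]
    have h4 : Real.log (-Real.log R) < (l + 1) * (ε * Real.log m) := by
      refine h1.trans_le ?_
      calc φ R * (ε * Real.log m) * -Real.log R
          = φ R * -Real.logb 2 R * Real.log 2 * (ε * Real.log m) := by rw [hlogR]; ring
        _ ≤ (l + 1) * (ε * Real.log m) := by
          refine mul_le_mul_of_nonneg_right ?_ hεm.le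
          have h5 := mul_le_mul_of_nonneg_right h3 hlog2.le
          have h6 : ((l : ℝ) + 1) * Real.log 2 ≤ (l + 1) * 1 :=
            mul_le_mul_of_nonneg_left hlog21 (by positivity)
          linarith
    have h5 : -Real.log R < y ^ (l + 1) := by
      rw [← Real.log_lt_log_iff (by linarith) (by positivity), Real.log_pow,
        Real.log_rpow hm0]
      push_cast
      exact h4
    have h6 : -Real.logb 2 R ≤ y / Real.log 2 * y ^ l := by
      rw [hlogR, pow_succ'] at h5
      rw [div_mul_eq_mul_div, le_div_iff₀ hlog2]
      exact h5.le
    have h7 : 0 ≤ |Real.logb 2 δ| * y ^ l := by positivity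
    linarith
  · have h1 : -Real.logb 2 R ≤ |Real.logb 2 δ| :=
      (neg_le_neg (Real.logb_le_logb_of_le one_lt_two hδ hRδ)).trans (neg_le_abs _)
    have h2 : |Real.logb 2 δ| ≤ |Real.logb 2 δ| * y ^ l :=
      le_mul_of_one_le_right (abs_nonneg _) hyl
    have h3 : 0 ≤ y / Real.log 2 * y ^ l := by positivity
    linarith

end Scales

theorem ae_exists_coverNumber_le {N : ℕ} {θ : PMF (Fin (N + 1))} (hm : 1 < offspringMean θ)
    {Ω : Type*} [MeasurableSpace Ω] {P : Measure Ω} [IsProbabilityMeasure P]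
    {X : List ℕ → Ω → Fin (N + 1)} (hX : ∀ u, Measurable (X u))
    (hlaw : ∀ u, P.map (X u) = θ.toMeasure) (hindep : iIndepFun X P)
    {ε : ℝ} (hε : 0 < ε) {φ : ℝ → ℝ}
    (hφ_gt : ∀ᶠ x in 𝓝[>] (0 : ℝ),
      Real.log |Real.log x| / |Real.log x| * (ε * Real.log (offspringMean θ))⁻¹ < φ x)
    {s : ℝ} (hs : (1 + ε) * (Real.log (offspringMean θ) / Real.log 2) < s) :
    ∀ᵐ ω ∂P, ∃ C > (0 : ℝ), ∀ r R : ℝ, 0 < r → r = R ^ (1 + φ R) → r < R → R < 1 →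
      ∀ x ∈ gromovBoundary (childCount X ω),
        coverNumber r (gromovBoundary (childCount X ω) ∩ Metric.closedBall x R) ≤
          ENNReal.ofReal (C * (R / r) ^ s) := by
  set m := offspringMean θ
  have hm0 : 0 < m := by linarith
  have hlogm : 0 < Real.log m := Real.log_pos hm
  have hlog2 : 0 < Real.log 2 := Real.log_pos one_lt_two
  have hs0 : 0 < s := lt_trans (by positivity) hs
  obtain ⟨C, hC, hlev⟩ := exists_ballLevel_le hm hε hφ_gt
  have hb : m * m ^ ε < 2 ^ s := by
    rw [← Real.log_lt_log_iff (by positivity) (by positivity),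
      Real.log_mul hm0.ne' (by positivity), Real.log_rpow hm0, Real.log_rpow two_pos]
    rw [← mul_div_assoc, div_lt_iff₀ hlog2] at hs
    linarith
  have hb1 : (1 : ℝ) ≤ 2 ^ s := Real.one_le_rpow one_le_two hs0.le
  filter_upwards [ae_card_descendants_lt hX hlaw hindep hm hC (Real.one_le_rpow hm.le hε.le) hb]
    with ω hω
  obtain ⟨l₀, hl₀⟩ := eventually_atTop.1 hω
  -- The first factor covers the finitely many `l < l₀` by the deterministic bound, the second the
  -- rounding of levels.
  refine ⟨((N : ℝ) + 1) ^ l₀ * 2 ^ s, by positivity, fun r R hr hrR hlt hR1 x hx => ?_⟩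
  refine (coverNumber_le_card_descendants hr hlt.le x).trans ?_
  set n := ballLevel R
  set l := ballLevel r - n
  have hN : (1 : ℝ) ≤ ((N : ℝ) + 1) ^ l₀ := one_le_pow₀ (by
    have : (0 : ℝ) ≤ N := Nat.cast_nonneg N
    linarith)
  have hbl : 1 ≤ ((2 : ℝ) ^ s) ^ l := one_le_pow₀ hb1
  have hcard : ((descendants (childCount X ω) l (x.vertex n)).card : ℝ) ≤
      ((N : ℝ) + 1) ^ l₀ * (2 ^ s) ^ l := by
    rcases le_or_gt l₀ l with hl | hl
    · have hv : x.vertex n ∈ descendants (fun _ => N) n [] := by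
        have := Ray.vertex_mem_descendants hx 0 n
        rw [zero_add] at this
        exact descendants_mono (childCount_le X ω) n [] this
      exact (hl₀ l hl n (hlev r R hr hrR hlt hR1) _ hv).le.trans
        (le_mul_of_one_le_left (by positivity) hN)
    · have h1 : (descendants (childCount X ω) l (x.vertex n)).card ≤ (N + 1) ^ l₀ :=
        (card_descendants_le (childCount_le X ω) l _).trans
          ((Nat.pow_le_pow_left (Nat.le_succ N) l).trans
            (Nat.pow_le_pow_right (Nat.succ_pos N) hl.le))
      have h2 : ((descendants (childCount X ω) l (x.vertex n)).card : ℝ) ≤ ((N : ℝ) + 1) ^ l₀ := by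
        exact_mod_cast h1
      exact h2.trans (le_mul_of_one_le_right (by positivity) hbl)
  rw [← ENNReal.ofReal_natCast]
  refine ENNReal.ofReal_le_ofReal (hcard.trans ?_)
  rw [mul_assoc]
  exact mul_le_mul_of_nonneg_left (rpow_ballLevel_sub_le hr hrR hlt hR1 hs0.le) (by positivity)

theorem mainTheorem3 {N : ℕ} (θ : PMF (Fin (N + 1))) (hm : 1 < offspringMean θ)
    {Ω : Type*} [MeasurableSpace Ω] (P : Measure Ω) [IsProbabilityMeasure P]
    (X : List ℕ → Ω → Fin (N + 1)) (hX : ∀ u, Measurable (X u))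
    (hlaw : ∀ u, P.map (X u) = θ.toMeasure) (hindep : iIndepFun X P)
    (ε : ℝ) (hε : 0 < ε) (φ : ℝ → ℝ) (hφ : IsDimensionFunction φ)
    (hφ_gt : ∀ᶠ x in 𝓝[>] (0 : ℝ),
      Real.log |Real.log x| / |Real.log x| * (ε * Real.log (offspringMean θ))⁻¹ < φ x) :
    ∀ᵐ ω ∂P, (∀ k, (treeLevel (fun u => (X u ω : ℕ)) k).Nonempty) →
      ∃ d : ℝ, HasBoxDim (gromovBoundary (fun u => (X u ω : ℕ))) d ∧
        phiAssouadDim φ (gromovBoundary (fun u => (X u ω : ℕ))) ≤ (((1 + ε) * d : ℝ) : EReal) := by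
  set d := Real.log (offspringMean θ) / Real.log 2
  -- The covering bound needs an exponent strictly above `(1 + ε) * d`; a sequence decreasing to it
  -- keeps one almost sure event.
  have hcov := ae_all_iff.2 fun j : ℕ => ae_exists_coverNumber_le hm hX hlaw hindep hε hφ_gt
    (s := (1 + ε) * d + 1 / ((j : ℝ) + 1)) (lt_add_of_pos_right _ (by positivity))
  filter_upwards [ae_tendsto_log_card hX hlaw hindep hm, hcov] with ω hω hcov hS
  obtain ⟨hpos, hD, hZ⟩ := hω (survives_root hS)
  refine ⟨d, hasBoxDim_gromovBoundary hpos hD hZ, ?_⟩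
  have hlim : Tendsto (fun j : ℕ => (((1 + ε) * d + 1 / ((j : ℝ) + 1) : ℝ) : EReal)) atTop
      (𝓝 (((1 + ε) * d : ℝ) : EReal)) := by
    refine (continuous_coe_real_ereal.tendsto _).comp ?_
    simpa using tendsto_one_div_add_atTop_nhds_zero_nat.const_add ((1 + ε) * d)
  exact ge_of_tendsto' hlim fun j => sInf_le ⟨_, hcov j, rfl⟩
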